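/- **Conventions.** Trees are finite rooted trees with open-ended leaves and root. $\Omega(T)$ is the coloured (symmetric) operad whose colours are the edges of $T$ and whose operations are freely generated by the vertices of $T$. $\Omega$ is the category of trees, with the maps of coloured operads $\Omega(R)\to\Omega(T)$ as arrows $R\to T$. A dendroidal set is a functor $\Omega^{op}\to Set$; $dSet$ is the category of dendroidal sets, $\Omega[T]$ is the representable one, and $N_d(\mathcal P)_T=Hom(\Omega(T),\mathcal P)$ is the nerve of a coloured operad $\mathcal P$. For an inner edge $e$ of $T$, the inner horn $\Lambda^e[T]\subseteq\Omega[T]$ is the union of all faces of $T$ except the inner face $\partial_e:T/e\to T$ (the faces are the inner faces, contracting an inner edge; the outer faces, deleting a vertex to which exactly one inner edge is attached together with the outer edges attached to it; and, if $T$ has exactly one vertex, the inclusions of its edges). A dendroidal set $K$ is an inner Kan complex if $Hom(\Omega[T],K)\to Hom(\Lambda^e[T],K)$ is surjective for every tree $T$ and every inner edge $e$ of $T$, and a strict one if this map is always bijective. Let $\mathbb S$ be a category with finite products, regarded as a coloured operad with operations $\mathbb S(c_1,\dots,c_n;d)=\mathbb S(c_1\times\dots\times c_n,d)$. For $t\in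 N_d(\mathbb S)_T$ let $in(t)=\prod_{l}t(l)$, the product over the leaves $l$ of $T$. For $\alpha:R\to T$ in $\Omega$ let $in(\alpha):in(t)\to in(\alpha^*t)$ be the arrow whose component at a leaf $l$ of $R$ is the projection of $in(t)$ to the leaves of $T$ above the edge $\alpha(l)$, followed by the arrow which $t$ assigns to the operation of $\Omega(T)$ from these leaves to $\alpha(l)$. For a diagram $X:\mathbb S^{op}\to dSet$, the dendroidal set $\int_{\mathbb S}X$ is defined as follows: a dendrex of shape $T$ is a pair $(t,x)$ of a $t\in N_d(\mathbb S)_T$ and a function $x$ which assigns to every arrow $r:R\to T$ of $\Omega$ an element $x(r)\in X(in(r^*t))_R$, such that $$\alpha^*(x(r))=X(in(\alpha))\bigl(x(r\alpha)\bigr)\qquad\text{for all } r:R\to T \text{ and } \alpha:U\to R \text{ in } \Omega;$$ an arrow $\beta:T'\to T$ acts by $\beta^*(t,x)=(\beta^*t,\,r\mapsto x(\beta r))$. **Theorem 8.2.** Let $\mathbb S$ be a category with finite products and $X:\mathbb S^{op}\to dSet$ a diagram of dendroidal sets. If $X(S)$ is an inner Kan complex for every object $S$ of $\mathbb S$, then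 $\int_{\mathbb S}X$ is an inner Kan complex. If $X(S)$ is a strict inner Kan complex for every object $S$ of $\mathbb S$, then $\int_{\mathbb S}X$ is a strict inner Kan complex. -/

import Mathlib

open CategoryTheory CategoryTheory.Limits Opposite

set_option linter.checkUnivs false

universe u v w u₁ v₁ u₂ v₂ u₃ v₃

namespace Dendroidal

/-! ### Coloured operads -/

/-- A symmetric coloured operad.  The inputs of an operation are indexed by an arbitrary finite
type `I`; the permutation action is the reindexing along bijections of such types. -/
structure ColouredOperad where
  /-- the colours -/
  Colour : Type u
  /-- `Op c d` is the set of operations with inputs `c i`, for `i : I`, and output `d` -/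
  Op : {I : Type} → [Finite I] → (I → Colour) → Colour → Type v
  /-- the units -/
  unit (c : Colour) : Op (fun _ : Unit => c) c
  /-- the action of bijections -/
  reindex {I I' : Type} [Finite I] [Finite I'] (σ : I ≃ I') {c : I' → Colour} {d : Colour} :
    Op c d → Op (fun i => c (σ i)) d
  /-- the composition -/
  comp {I : Type} [Finite I] {J : I → Type} [∀ i, Finite (J i)] {c : I → Colour} {d : Colour}
    {b : ∀ i, J i → Colour} :
    Op c d → (∀ i, Op (b i) (c i)) → Op (fun x : Σ i, J i => b x.1 x.2) d
  reindex_refl {I : Type} [Finite I] {c : I → Colour} {d : Colour} (p : Op c d) :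
    reindex (Equiv.refl I) p = p
  reindex_trans {I I' I'' : Type} [Finite I] [Finite I'] [Finite I''] (σ : I ≃ I') (τ : I' ≃ I'')
    {c : I'' → Colour} {d : Colour} (p : Op c d) :
    reindex (σ.trans τ) p = reindex σ (reindex τ p)
  comp_reindex_left {I I' : Type} [Finite I] [Finite I'] (σ : I ≃ I') {J : I' → Type}
    [∀ i, Finite (J i)] {c : I' → Colour} {d : Colour} {b : ∀ i, J i → Colour}
    (p : Op c d) (q : ∀ i, Op (b i) (c i)) :
    comp (reindex σ p) (fun i => q (σ i)) =
      reindex (Equiv.sigmaCongrLeft (β := J) σ) (comp p q)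
  comp_reindex_right {I : Type} [Finite I] {J J' : I → Type} [∀ i, Finite (J i)]
    [∀ i, Finite (J' i)] (τ : ∀ i, J i ≃ J' i) {c : I → Colour} {d : Colour}
    {b : ∀ i, J' i → Colour} (p : Op c d) (q : ∀ i, Op (b i) (c i)) :
    comp p (fun i => reindex (τ i) (q i)) = reindex (Equiv.sigmaCongrRight τ) (comp p q)
  unit_comp {I : Type} [Finite I] {c : I → Colour} {d : Colour} (p : Op c d) :
    comp (unit d) (fun _ => p) = reindex (Equiv.uniqueSigma (fun _ : Unit => I)) p
  comp_unit {I : Type} [Finite I] {c : I → Colour} {d : Colour} (p : Op c d) :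
    comp p (fun i => unit (c i)) = reindex (Equiv.sigmaUnique I (fun _ => Unit)) p
  assoc {I : Type} [Finite I] {J : I → Type} [∀ i, Finite (J i)] {K : ∀ i, J i → Type}
    [∀ i j, Finite (K i j)] {c : I → Colour} {d : Colour} {b : ∀ i, J i → Colour}
    {a : ∀ i j, K i j → Colour} (p : Op c d) (q : ∀ i, Op (b i) (c i))
    (r : ∀ i j, Op (a i j) (b i j)) :
    comp (comp p q) (fun x => r x.1 x.2) =
      reindex (Equiv.sigmaAssoc K) (comp p (fun i => comp (q i) (r i)))

/-- A map of coloured operads. -/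
structure OperadHom (P : ColouredOperad.{u₁, v₁}) (Q : ColouredOperad.{u₂, v₂}) where
  /-- the action on colours -/
  colour : P.Colour → Q.Colour
  /-- the action on operations -/
  map {I : Type} [Finite I] {c : I → P.Colour} {d : P.Colour} :
    P.Op c d → Q.Op (fun i => colour (c i)) (colour d)
  map_unit (c : P.Colour) : map (P.unit c) = Q.unit (colour c)
  map_reindex {I I' : Type} [Finite I] [Finite I'] (σ : I ≃ I') {c : I' → P.Colour}
    {d : P.Colour} (p : P.Op c d) : map (P.reindex σ p) = Q.reindex σ (map p)
  map_comp {I : Type} [Finite I] {J : I → Type} [∀ i, Finite (J i)] {c : I → P.Colour}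
    {d : P.Colour} {b : ∀ i, J i → P.Colour} (p : P.Op c d) (q : ∀ i, P.Op (b i) (c i)) :
    map (P.comp p q) = Q.comp (map p) (fun i => map (q i))

/-- Composition of maps of operads, in diagrammatic order. -/
def OperadHom.comp {P : ColouredOperad.{u₁, v₁}} {Q : ColouredOperad.{u₂, v₂}}
    {R : ColouredOperad.{u₃, v₃}} (f : OperadHom P Q) (g : OperadHom Q R) : OperadHom P R where
  colour c := g.colour (f.colour c)
  map p := g.map (f.map p)
  map_unit c := by rw [f.map_unit, g.map_unit]
  map_reindex σ _ _ p := by rw [f.map_reindex, g.map_reindex]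
  map_comp p q := by rw [f.map_comp, g.map_comp]

/-! ### Trees and the operads they generate -/

/-- A finite rooted tree with open-ended leaves and root.  Every vertex has one output edge, and
different vertices have different output edges; every edge other than the root is an input edge of
exactly one vertex; from every edge, walking downwards one reaches the root. -/
structure OpTree where
  /-- the edges -/
  Edge : Type
  /-- the vertices -/
  Vertex : Type
  finite_edge : Finite Edge
  /-- the root edge -/
  root : Edge
  /-- the output edge of a vertex -/
  out : Vertex → Edge
  out_injective : Function.Injective out
  /-- the vertex of which a given edge, different from the root, is an input -/
  below (a : Edge) : a ≠ root → Vertex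
  walk (a : Edge) :
    Relation.ReflTransGen (fun a b : Edge => ∃ h : a ≠ root, out (below a h) = b) a root

namespace OpTree

attribute [instance] OpTree.finite_edge

variable (T : OpTree)

instance finite_vertex : Finite T.Vertex := Finite.of_injective T.out T.out_injective

/-- `T.Step a b`: the edge `b` is the output of the vertex of which `a` is an input. -/
def Step (a b : T.Edge) : Prop := ∃ h : a ≠ T.root, T.out (T.below a h) = b

/-- `T.IsInput v a`: the edge `a` is an input edge of the vertex `v`. -/
def IsInput (v : T.Vertex) (a : T.Edge) : Prop := ∃ h : a ≠ T.root, T.below a h = v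

/-- The input edges of a vertex. -/
abbrev Input (v : T.Vertex) : Type := {a : T.Edge // T.IsInput v a}

/-- A leaf is an edge which is not the output of a vertex. -/
def IsLeaf (a : T.Edge) : Prop := ∀ v, T.out v ≠ a

/-- The leaves of a tree. -/
abbrev Leaf : Type := {a : T.Edge // T.IsLeaf a}

/-- An edge is inner if it is neither the root nor a leaf, and outer otherwise. -/
def IsInner (a : T.Edge) : Prop := a ≠ T.root ∧ ¬ T.IsLeaf a

/-- The inner edges of a tree. -/
abbrev InnerEdge : Type := {a : T.Edge // T.IsInner a}

/-- `T.IsAttached v a`: the edge `a` is the output or an input of the vertex `v`. -/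
def IsAttached (v : T.Vertex) (a : T.Edge) : Prop := T.out v = a ∨ T.IsInput v a

/-- `T.Above a b`: the unique path from the edge `a` down to the root passes through `b`
(and possibly `a = b`). -/
def Above (a b : T.Edge) : Prop := Relation.ReflTransGen T.Step a b

/-- The signatures of the operations generated by the vertices of the tree under units,
permutations and compositions. -/
inductive Gen : {I : Type} → (I → T.Edge) → T.Edge → Prop
  | unit (a : T.Edge) : Gen (fun _ : Unit => a) a
  | vertex (v : T.Vertex) : Gen (fun a : T.Input v => a.1) (T.out v)
  | reindex {I I' : Type} (σ : I ≃ I') {c : I' → T.Edge} {d : T.Edge} (h : Gen c d) :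
      Gen (fun i => c (σ i)) d
  | comp {I : Type} {J : I → Type} {c : I → T.Edge} {d : T.Edge} {b : ∀ i, J i → T.Edge}
      (h : Gen c d) (h' : ∀ i, Gen (b i) (c i)) : Gen (fun x : Σ i, J i => b x.1 x.2) d

/-- The coloured operad `Ω(T)` of a tree: its colours are the edges, and its operations are
generated by the vertices.  It is free on the vertices of `T`, and there is at most one operation
with given inputs and output. -/
def operad : ColouredOperad.{0, 0} where
  Colour := T.Edge
  Op c d := PLift (T.Gen c d)
  unit a := ⟨.unit a⟩
  reindex σ _ _ p := ⟨.reindex σ p.down⟩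
  comp p q := ⟨.comp p.down fun i => (q i).down⟩
  reindex_refl _ := rfl
  reindex_trans _ _ _ _ _ := rfl
  comp_reindex_left := by intros; rfl
  comp_reindex_right := by intros; rfl
  unit_comp _ := rfl
  comp_unit _ := rfl
  assoc := by intros; rfl

/-- A morphism of trees is a map of coloured operads `Ω(T) → Ω(T')`.  As there is at most one
operation with a given signature, it amounts to a function on edges which sends
(signatures of) operations to operations; see `homEquiv`. -/
instance category : Category.{0, 1} OpTree where
  Hom T T' := {f : T.Edge → T'.Edge //
    ∀ {I : Type} {c : I → T.Edge} {d : T.Edge}, T.Gen c d → T'.Gen (fun i => f (c i)) (f d)}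
  id T := ⟨fun a => a, fun h => h⟩
  comp f g := ⟨fun a => g.1 (f.1 a), fun h => g.2 (f.2 h)⟩

variable {T}

/-- The map of operads underlying a morphism of trees. -/
def operadHom {T T' : OpTree} (f : T ⟶ T') : OperadHom T.operad T'.operad where
  colour := f.1
  map p := ⟨f.2 p.down⟩
  map_unit _ := rfl
  map_reindex _ _ _ _ := rfl
  map_comp _ _ := rfl

theorem Gen.finite {I : Type} {c : I → T.Edge} {d : T.Edge} (h : T.Gen c d) : Finite I := by
  induction h with
  | unit => infer_instance
  | vertex v => infer_instance
  | reindex σ _ ih => exact Finite.of_equiv _ σ.symm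
  | comp _ _ ih ih' => exact Finite.instSigma

/-- Morphisms of trees are the same as maps of the corresponding operads. -/
def homEquiv (T T' : OpTree) : (T ⟶ T') ≃ OperadHom T.operad T'.operad where
  toFun := operadHom
  invFun F := ⟨F.colour, fun {I c d} h =>
    have := h.finite
    (F.map (I := I) (c := c) (d := d) (PLift.up h)).down⟩
  left_inv _ := rfl
  right_inv _ := rfl

/-! ### Elementary facts on trees -/

theorem Step.rightUnique : Relator.RightUnique T.Step := by
  rintro a b c ⟨h, rfl⟩ ⟨h', rfl⟩
  rfl

theorem above_root (a : T.Edge) : T.Above a T.root := T.walk a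

theorem acyclic (a : T.Edge) : ¬ Relation.TransGen T.Step a a := by
  induction T.above_root a using Relation.ReflTransGen.head_induction_on with
  | refl =>
    intro h
    obtain ⟨c, ⟨h, _⟩, _⟩ := Relation.TransGen.head'_iff.1 h
    exact h rfl
  | head hab _ ih =>
    intro h
    obtain ⟨c, hac, hca⟩ := Relation.TransGen.head'_iff.1 h
    obtain rfl := Step.rightUnique hab hac
    exact ih (Relation.TransGen.tail'_iff.2 ⟨_, hca, hab⟩)

theorem IsInput.step {v : T.Vertex} {a : T.Edge} (h : T.IsInput v a) : T.Step a (T.out v) := by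
  obtain ⟨h, rfl⟩ := h
  exact ⟨h, rfl⟩

theorem Step.isInput {v : T.Vertex} {a : T.Edge} (h : T.Step a (T.out v)) : T.IsInput v a := by
  obtain ⟨h, h'⟩ := h
  exact ⟨h, T.out_injective h'⟩

theorem IsInput.ne_out {v : T.Vertex} {a : T.Edge} (h : T.IsInput v a) : a ≠ T.out v := by
  intro e
  have h' := h.step
  rw [← e] at h'
  exact T.acyclic a (.single h')

theorem IsInput.unique {v : T.Vertex} {a b b' : T.Edge} (hb : T.IsInput v b)
    (hb' : T.IsInput v b') (h : T.Above a b) (h' : T.Above a b') : b = b' := by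
  have key : ∀ {b b' : T.Edge}, T.IsInput v b → T.IsInput v b' → T.Above b b' → b = b' := by
    intro b b' hb hb' h
    rcases Relation.ReflTransGen.cases_head h with e | ⟨c, hc, hcb⟩
    · exact e
    · obtain rfl := Step.rightUnique hb.step hc
      exact absurd (Relation.TransGen.tail'_iff.2 ⟨_, hcb, hb'.step⟩) (T.acyclic _)
  rcases Relation.ReflTransGen.total_of_right_unique Step.rightUnique h h' with h | h
  · exact key hb hb' h
  · exact (key hb' hb h).symm

/-- Induction from the leaves down to the root. -/
theorem wellFounded_step : WellFounded T.Step := by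
  have h : WellFounded (Relation.TransGen T.Step) := by
    have : Std.Irrefl (Relation.TransGen T.Step) := ⟨T.acyclic⟩
    exact Finite.wellFounded_of_trans_of_irrefl _
  exact Subrelation.wf (fun h => Relation.TransGen.single h) h

/-- The leaves above a given edge. -/
abbrev LeafAbove (T : OpTree) (a : T.Edge) : Type := {l : T.Edge // T.IsLeaf l ∧ T.Above l a}

/-- For every edge `a`, there is an operation whose inputs are the leaves above `a` and whose
output is `a` (given by the whole subtree above `a`). -/
theorem gen_leafAbove (a : T.Edge) : T.Gen (fun l : T.LeafAbove a => l.1) a := by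
  induction a using T.wellFounded_step.induction with
  | _ a ih =>
  by_cases ha : T.IsLeaf a
  · have huniq : ∀ l : T.LeafAbove a, l.1 = a := by
      intro l
      rcases Relation.ReflTransGen.cases_tail l.2.2 with e | ⟨c, _, ⟨_, h⟩⟩
      · exact e.symm
      · exact absurd h (ha _)
    let σ : T.LeafAbove a ≃ Unit :=
      { toFun := fun _ => ()
        invFun := fun _ => ⟨a, ha, .refl⟩
        left_inv := fun l => Subtype.ext (huniq l).symm
        right_inv := fun _ => rfl }
    have h := Gen.reindex σ (Gen.unit a)
    have e : (fun l : T.LeafAbove a => l.1) = fun _ => a := funext huniq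
    rw [e]
    exact h
  · obtain ⟨v, rfl⟩ : ∃ v, T.out v = a := by simpa [IsLeaf] using ha
    have hex : ∀ l : T.LeafAbove (T.out v), ∃ b, T.IsInput v b ∧ T.Above l.1 b := by
      intro l
      rcases Relation.ReflTransGen.cases_tail l.2.2 with e | ⟨c, hlc, hc⟩
      · exact absurd e (l.2.1 v)
      · exact ⟨c, hc.isInput, hlc⟩
    choose g hg hg' using hex
    let σ : T.LeafAbove (T.out v) ≃ Σ b : T.Input v, T.LeafAbove b.1 :=
      { toFun := fun l => ⟨⟨g l, hg l⟩, ⟨l.1, l.2.1, hg' l⟩⟩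
        invFun := fun x => ⟨x.2.1, x.2.2.1, x.2.2.2.tail x.1.2.step⟩
        left_inv := fun _ => rfl
        right_inv := by
          rintro ⟨⟨b, hb⟩, ⟨l, hl, hl'⟩⟩
          have key : ∀ (b' : T.Edge) (hb' : T.IsInput v b') (h : T.Above l b'), b' = b →
              (⟨⟨b', hb'⟩, ⟨l, hl, h⟩⟩ : Σ b : T.Input v, T.LeafAbove b.1) =
                ⟨⟨b, hb⟩, ⟨l, hl, hl'⟩⟩ := by
            rintro b' hb' h rfl
            rfl
          exact key _ _ (hg' ⟨l, hl, hl'.tail hb.step⟩) (IsInput.unique (hg ⟨l, hl, hl'.tail hb.step⟩) hb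
            (hg' ⟨l, hl, hl'.tail hb.step⟩) hl') }
    exact Gen.reindex σ (Gen.comp (Gen.vertex v) fun b => ih b.1 b.2.step)

/-- A function on edges which sends the vertices of `T` to operations of `T'` is a morphism. -/
def homMk {T T' : OpTree} (f : T.Edge → T'.Edge)
    (hf : ∀ v, T'.Gen (fun a : T.Input v => f a.1) (f (T.out v))) : T ⟶ T' :=
  ⟨f, fun {I c d} h => by
    induction h with
    | unit a => exact .unit _
    | vertex v => exact hf v
    | reindex σ _ ih => exact .reindex σ ih
    | comp _ _ ih ih' => exact .comp ih ih'⟩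

/-! ### Faces -/

/-- The tree `η` with a single edge and no vertex. -/
def eta : OpTree where
  Edge := Unit
  Vertex := Empty
  finite_edge := inferInstance
  root := ()
  out v := v.elim
  out_injective v := v.elim
  below a h := (h rfl).elim
  walk _ := .refl

/-- The map `η ⟶ T` which sends the edge of `η` to the edge `a`. -/
def edgeMap (a : T.Edge) : eta ⟶ T := homMk (fun _ => a) fun v => v.elim

theorem InnerEdge.out_below_ne (e : T.InnerEdge) :
    T.out (T.below e.1 e.2.1) ≠ e.1 := fun h => T.acyclic e.1 (.single ⟨e.2.1, h⟩)

theorem InnerEdge.exists_out (e : T.InnerEdge) : ∃ v, T.out v = e.1 := by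
  have h := e.2.2
  simpa [IsLeaf] using h

open Classical in
/-- The tree `T/e` obtained by contracting the inner edge `e`.  The vertex `v` with output `e` is
merged into the vertex `w` of which `e` is an input; the merged vertex is denoted `w` again. -/
noncomputable def contract (T : OpTree) (e : T.InnerEdge) : OpTree where
  Edge := {a : T.Edge // a ≠ e.1}
  Vertex := {v : T.Vertex // T.out v ≠ e.1}
  finite_edge := inferInstance
  root := ⟨T.root, e.2.1.symm⟩
  out v := ⟨T.out v.1, v.2⟩
  out_injective v v' h := Subtype.ext (T.out_injective (congrArg Subtype.val h))
  below a h :=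
    if h' : T.out (T.below a.1 fun h' => h (Subtype.ext h')) = e.1 then
      ⟨T.below e.1 e.2.1, e.out_below_ne⟩
    else ⟨T.below a.1 fun h' => h (Subtype.ext h'), h'⟩
  walk := by
    rintro ⟨a, ha⟩
    have key : ∀ (R : {a : T.Edge // a ≠ e.1} → {a : T.Edge // a ≠ e.1} → Prop),
        (∀ a b, T.Step a.1 b.1 → R a b) →
        (∀ a b, T.Step a.1 e.1 → T.Step e.1 b.1 → R a b) →
        Relation.ReflTransGen R ⟨a, ha⟩ ⟨T.root, e.2.1.symm⟩ := by
      intro R h₁ h₂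
      suffices h : (∀ ha : a ≠ e.1, Relation.ReflTransGen R ⟨a, ha⟩ ⟨T.root, e.2.1.symm⟩) ∧
          (∀ b : {a : T.Edge // a ≠ e.1}, a = e.1 → T.Step a b.1 →
            Relation.ReflTransGen R b ⟨T.root, e.2.1.symm⟩) from h.1 ha
      clear ha
      induction T.above_root a using Relation.ReflTransGen.head_induction_on with
      | refl => exact ⟨fun _ => .refl, fun _ h => absurd h.symm e.2.1⟩
      | @head a b hab _ ih =>
        constructor
        · intro ha
          by_cases hb : b = e.1
          · let c : {a : T.Edge // a ≠ e.1} := ⟨T.out (T.below e.1 e.2.1), e.out_below_ne⟩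
            have hc : T.Step b c.1 := by rw [hb]; exact ⟨e.2.1, rfl⟩
            exact .head (h₂ ⟨a, ha⟩ c (hb ▸ hab) (hb ▸ hc)) (ih.2 c hb hc)
          · exact .head (h₁ ⟨a, ha⟩ ⟨b, hb⟩ hab) (ih.1 hb)
        · intro c _ hc
          obtain rfl := Step.rightUnique hab hc
          exact ih.1 c.2
    refine key _ ?_ ?_
    · rintro ⟨a, ha⟩ ⟨b, hb⟩ ⟨h, rfl⟩
      refine ⟨fun h' => h (congrArg Subtype.val h'), ?_⟩
      rw [dif_neg hb]
    · rintro ⟨a, ha⟩ ⟨b, hb⟩ ⟨h, h'⟩ ⟨h'', rfl⟩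
      refine ⟨fun h' => h (congrArg Subtype.val h'), ?_⟩
      rw [dif_pos h']

theorem contract_isInput_iff (e : T.InnerEdge) (v : (T.contract e).Vertex)
    (a : (T.contract e).Edge) : (T.contract e).IsInput v a ↔
      T.IsInput v.1 a.1 ∨ (T.IsInput v.1 e.1 ∧ T.Step a.1 e.1) := by
  obtain ⟨v, hv⟩ := v
  obtain ⟨a, ha⟩ := a
  constructor
  · rintro ⟨h, h'⟩
    have ha' : a ≠ T.root := fun h' => h (Subtype.ext h')
    by_cases hb : T.out (T.below a ha') = e.1
    · right
      have h'' := congrArg Subtype.val h'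
      dsimp only [contract] at h''
      rw [dif_pos hb] at h''
      exact ⟨⟨e.2.1, h''⟩, ⟨ha', hb⟩⟩
    · left
      have h'' := congrArg Subtype.val h'
      dsimp only [contract] at h''
      rw [dif_neg hb] at h''
      exact ⟨ha', h''⟩
  · rintro (⟨h, h'⟩ | ⟨⟨h, h'⟩, ⟨h₁, h₂⟩⟩)
    · refine ⟨fun h' => h (congrArg Subtype.val h'), Subtype.ext ?_⟩
      have hb : T.out (T.below a h) ≠ e.1 := by rw [h']; exact hv
      dsimp only [contract]
      rw [dif_neg hb]
      exact h'
    · refine ⟨fun h' => h₁ (congrArg Subtype.val h'), Subtype.ext ?_⟩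
      dsimp only [contract]
      rw [dif_pos h₂]
      exact h'

/-- The inner face map `∂_e : T/e ⟶ T`, given by the inclusion of edges; it sends the merged vertex
to the composition of the two vertices attached to `e`. -/
noncomputable def contractMap (e : T.InnerEdge) : T.contract e ⟶ T :=
  homMk (fun a => a.1) fun v => by
    obtain ⟨u, hu⟩ := e.exists_out
    let J : T.Input v.1 → Type := fun a =>
      {x : T.Edge // (a.1 ≠ e.1 ∧ x = a.1) ∨ (a.1 = e.1 ∧ T.IsInput u x)}
    have hJ : ∀ a : T.Input v.1, T.Gen (fun x : J a => x.1) a.1 := by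
      intro a
      by_cases ha : a.1 = e.1
      · let σ : J a ≃ T.Input u :=
          { toFun := fun x => ⟨x.1, x.2.elim (fun h => absurd ha h.1) fun h => h.2⟩
            invFun := fun x => ⟨x.1, Or.inr ⟨ha, x.2⟩⟩
            left_inv := fun _ => rfl
            right_inv := fun _ => rfl }
        have h := Gen.reindex σ (Gen.vertex u)
        rw [hu, ← ha] at h
        exact h
      · have huniq : ∀ x : J a, x.1 = a.1 := fun x =>
          x.2.elim (fun h => h.2) fun h => absurd h.1 ha
        let σ : J a ≃ Unit :=
          { toFun := fun _ => ()
            invFun := fun _ => ⟨a.1, Or.inl ⟨ha, rfl⟩⟩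
            left_inv := fun x => Subtype.ext (huniq x).symm
            right_inv := fun _ => rfl }
        have h := Gen.reindex σ (Gen.unit a.1)
        have e : (fun x : J a => x.1) = fun _ => a.1 := funext huniq
        rw [e]
        exact h
    have hne : ∀ x, T.IsInput u x → ¬ T.IsInput v.1 x := by
      rintro x ⟨h, h'⟩ ⟨h₁, h₂⟩
      exact v.2 (by rw [← h₂, h', hu])
    let f : (Σ a : T.Input v.1, J a) → (T.contract e).Input v := fun x =>
      ⟨⟨x.2.1, by
        rcases x.2.2 with ⟨h, h'⟩ | ⟨h, h'⟩
        · rw [h']; exact h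
        · exact fun h'' => h'.ne_out (h''.trans hu.symm)⟩, (contract_isInput_iff e v _).2 (by
        rcases x.2.2 with ⟨h, h'⟩ | ⟨h, h'⟩
        · left; rw [h']; exact x.1.2
        · right
          have h₁ := x.1.2
          have h₂ := h'.step
          rw [h] at h₁
          rw [hu] at h₂
          exact ⟨h₁, h₂⟩)⟩
    have hf : Function.Bijective f := by
      constructor
      · rintro ⟨⟨a, ha⟩, ⟨x, hx⟩⟩ ⟨⟨a', ha'⟩, ⟨x', hx'⟩⟩ h
        obtain rfl : x = x' := congrArg (fun y => y.1.1) h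
        have haa : a = a' := by
          rcases hx with ⟨h₁, h₂⟩ | ⟨h₁, h₂⟩ <;> rcases hx' with ⟨h₃, h₄⟩ | ⟨h₃, h₄⟩
          · exact h₂.symm.trans h₄
          · exact absurd (by rw [h₂]; exact ha) (hne _ h₄)
          · exact absurd (by rw [h₄]; exact ha') (hne _ h₂)
          · exact h₁.trans h₃.symm
        subst haa
        rfl
      · rintro ⟨⟨x, hx⟩, h⟩
        rcases (contract_isInput_iff e v _).1 h with h' | ⟨h', h''⟩
        · exact ⟨⟨⟨x, h'⟩, ⟨x, Or.inl ⟨hx, rfl⟩⟩⟩, rfl⟩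
        · exact ⟨⟨⟨e.1, h'⟩, ⟨x, Or.inr ⟨rfl, Step.isInput (hu ▸ h'')⟩⟩⟩, rfl⟩
    have h := Gen.reindex (Equiv.ofBijective f hf).symm (Gen.comp (Gen.vertex v.1) hJ)
    have e' : (fun a : (T.contract e).Input v => a.1.1) =
        fun a => ((Equiv.ofBijective f hf).symm a).2.1 := by
      funext a
      have := congrArg (fun y => y.1.1) ((Equiv.ofBijective f hf).apply_symm_apply a)
      exact this.symm
    rw [e']
    exact h

/-- A vertex to which exactly one inner edge is attached. -/
abbrev OuterVertex (T : OpTree) : Type :=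
  {v : T.Vertex // ∃! a, T.IsAttached v a ∧ T.IsInner a}

/-- The edges which remain when `v` and the outer edges attached to it are deleted. -/
def Remains (v : T.OuterVertex) (a : T.Edge) : Prop := T.IsAttached v.1 a → T.IsInner a

theorem remains_out (v : T.OuterVertex) {w : T.Vertex} (hw : w ≠ v.1) : T.Remains v (T.out w) := by
  rintro (h | h)
  · exact absurd (T.out_injective h).symm hw
  · obtain ⟨h, _⟩ := h
    exact ⟨h, fun h' => h' w rfl⟩

open Classical in
/-- The root of `T/v`. -/
noncomputable def pruneRoot (v : T.OuterVertex) : {a : T.Edge // T.Remains v a} :=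
  if h : T.Remains v T.root then ⟨T.root, h⟩
  else ⟨v.2.choose, fun _ => v.2.choose_spec.1.2⟩

theorem ne_root_of_ne_pruneRoot (v : T.OuterVertex) {a : {a : T.Edge // T.Remains v a}}
    (h : a ≠ pruneRoot v) : a.1 ≠ T.root := by
  intro ha
  have hr : T.Remains v T.root := ha ▸ a.2
  apply h
  rw [pruneRoot, dif_pos hr]
  exact Subtype.ext ha

theorem below_ne_of_ne_pruneRoot (v : T.OuterVertex) {a : {a : T.Edge // T.Remains v a}}
    (h : a ≠ pruneRoot v) : T.below a.1 (ne_root_of_ne_pruneRoot v h) ≠ v.1 := by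
  intro hv
  have hin : T.IsInput v.1 a.1 := ⟨_, hv⟩
  have ha : T.IsInner a.1 := a.2 (Or.inr hin)
  by_cases hr : T.Remains v T.root
  · have hout : T.out v.1 ≠ T.root := fun h' => (hr (Or.inl h')).1 rfl
    exact hin.ne_out (v.2.unique ⟨Or.inr hin, ha⟩ ⟨Or.inl rfl, hout, fun h' => h' _ rfl⟩)
  · apply h
    rw [pruneRoot, dif_neg hr]
    exact Subtype.ext (v.2.unique ⟨Or.inr hin, ha⟩ v.2.choose_spec.1)

/-- The tree `T/v` obtained by deleting a vertex `v` to which exactly one inner edge is attached,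
together with all outer edges attached to it.  If `v` is the root vertex, the inner edge attached
to `v` becomes the root. -/
noncomputable def prune (T : OpTree) (v : T.OuterVertex) : OpTree where
  Edge := {a : T.Edge // T.Remains v a}
  Vertex := {w : T.Vertex // w ≠ v.1}
  finite_edge := inferInstance
  root := pruneRoot v
  out w := ⟨T.out w.1, remains_out v w.2⟩
  out_injective w w' h := Subtype.ext (T.out_injective (congrArg Subtype.val h))
  below a h := ⟨T.below a.1 (ne_root_of_ne_pruneRoot v h), below_ne_of_ne_pruneRoot v h⟩
  walk := by
    rintro ⟨a, ha⟩
    induction T.above_root a using Relation.ReflTransGen.head_induction_on with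
    | refl =>
      have key : ∀ (R : {a : T.Edge // T.Remains v a} → {a : T.Edge // T.Remains v a} → Prop)
          (b : {a : T.Edge // T.Remains v a}), ⟨T.root, ha⟩ = b →
          Relation.ReflTransGen R ⟨T.root, ha⟩ b := fun _ _ h => h ▸ .refl
      exact key _ _ (by rw [pruneRoot, dif_pos ha])
    | @head a b hab _ ih =>
      by_cases h : (⟨a, ha⟩ : {a : T.Edge // T.Remains v a}) = pruneRoot v
      · rw [h]
      · obtain ⟨h', rfl⟩ := hab
        exact .head ⟨h, rfl⟩ (ih (remains_out v (below_ne_of_ne_pruneRoot v h)))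

/-- The outer face map `∂_v : T/v ⟶ T`, given by the inclusion of edges. -/
noncomputable def pruneMap (v : T.OuterVertex) : T.prune v ⟶ T :=
  homMk (fun a => a.1) fun w => by
    have hin : ∀ a : T.Input w.1, T.Remains v a.1 := by
      rintro ⟨a, ⟨ha, haw⟩⟩ (h | ⟨_, h⟩)
      · exact ⟨ha, fun h' => h' _ h⟩
      · exact absurd (haw.symm.trans h) w.2
    have hroot : ∀ a : T.Input w.1, (⟨a.1, hin a⟩ : {a : T.Edge // T.Remains v a}) ≠
        pruneRoot v := by
      rintro ⟨a, ha⟩ h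
      by_cases hr : T.Remains v T.root
      · rw [pruneRoot, dif_pos hr] at h
        exact ha.1 (congrArg Subtype.val h)
      · rw [pruneRoot, dif_neg hr] at h
        have h' : a = v.2.choose := congrArg Subtype.val h
        have hv : T.out v.1 = T.root := by
          by_contra hne
          exact hr fun h₁ => h₁.elim (fun h₂ => absurd h₂ hne) fun h₂ => absurd rfl h₂.1
        rcases v.2.choose_spec.1.1 with h₁ | ⟨_, h₁⟩
        · exact v.2.choose_spec.1.2.1 (h₁.symm.trans hv)
        · apply w.2
          rw [← ha.2, ← h₁]
          congr 1
    let σ : (T.prune v).Input w ≃ T.Input w.1 :=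
      { toFun := fun a => ⟨a.1.1, by
          obtain ⟨h, h'⟩ := a.2
          exact ⟨ne_root_of_ne_pruneRoot v h, congrArg Subtype.val h'⟩⟩
        invFun := fun a => ⟨⟨a.1, hin a⟩, ⟨hroot a, Subtype.ext a.2.2⟩⟩
        left_inv := fun _ => rfl
        right_inv := fun _ => rfl }
    exact Gen.reindex σ (Gen.vertex w.1)

/-- The elementary faces of a tree: the inner faces, the outer faces and, for a tree with exactly
one vertex, the inclusions of its edges. -/
inductive Face (T : OpTree) : Type
  | inner (e : T.InnerEdge)
  | outer (v : T.OuterVertex)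
  | edge (h : Nat.card T.Vertex = 1) (a : T.Edge)

/-- The source of a face map. -/
noncomputable def Face.source : T.Face → OpTree
  | .inner e => T.contract e
  | .outer v => T.prune v
  | .edge _ _ => eta

/-- The face map. -/
noncomputable def Face.map : (F : T.Face) → (F.source ⟶ T)
  | .inner e => contractMap e
  | .outer v => pruneMap v
  | .edge _ a => edgeMap a

end OpTree

/-! ### Dendroidal sets and inner Kan complexes -/

/-- Dendroidal sets: presheaves on the category of trees. -/
abbrev DSet : Type (max 1 (w + 1)) := OpTreeᵒᵖ ⥤ Type w

/-- The representable dendroidal set `Ω[T]`. -/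
abbrev representable (T : OpTree) : DSet.{w} := uliftYoneda.{w}.obj T

/-- The inner horn `Λ^e[T] ⊆ Ω[T]`: the union of (the images of) all faces of `T` except `∂_e`. -/
noncomputable def innerHorn (T : OpTree) (e : T.InnerEdge) : Subfunctor (representable.{w} T) :=
  ⨆ (F : T.Face) (_ : F ≠ .inner e), Subfunctor.range (uliftYoneda.{w}.map F.map)

/-- Restriction `Hom(Ω[T], K) → Hom(Λ^e[T], K)` along the inclusion of the inner horn. -/
noncomputable def restrictToHorn (K : DSet.{w}) (T : OpTree) (e : T.InnerEdge)
    (f : representable.{w} T ⟶ K) : (innerHorn.{w} T e).toFunctor ⟶ K :=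
  (innerHorn.{w} T e).ι ≫ f

/-- A dendroidal set is an inner Kan complex if every inner horn in it has a filler. -/
def IsInnerKan (K : DSet.{w}) : Prop :=
  ∀ (T : OpTree) (e : T.InnerEdge), Function.Surjective (restrictToHorn K T e)

/-- A dendroidal set is a strict inner Kan complex if every inner horn in it has a unique filler. -/
def IsStrictInnerKan (K : DSet.{w}) : Prop :=
  ∀ (T : OpTree) (e : T.InnerEdge), Function.Bijective (restrictToHorn K T e)

/-- The dendroidal nerve of a coloured operad: `N_d(P)_T = Hom(Ω(T), P)`. -/
def nerve (P : ColouredOperad.{u, v}) : DSet.{max 1 u v} where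
  obj T := OperadHom T.unop.operad P
  map f := ↾fun t => (OpTree.operadHom f.unop).comp t

/-! ### A category with finite products as an operad -/

section Cartesian

variable (S : Type u) [Category.{v} S] [HasFiniteProducts S]

variable {S} in
theorem pi_hom_ext_equiv {I I' : Type} [Finite I] [Finite I'] (σ : I ≃ I') {c : I' → S} {A : S}
    {f g : A ⟶ ∏ᶜ c} (h : ∀ i, f ≫ Pi.π c (σ i) = g ≫ Pi.π c (σ i)) : f = g := by
  refine Pi.hom_ext _ _ fun i' => ?_
  obtain ⟨i, rfl⟩ := σ.surjective i'
  exact h i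

/-- A category with finite products, regarded as a coloured operad: the colours are the objects,
and the operations with inputs `c i` and output `d` are the arrows `∏ᶜ c ⟶ d`. -/
noncomputable def cartesianOperad : ColouredOperad.{u, v} where
  Colour := S
  Op c d := ∏ᶜ c ⟶ d
  unit c := Pi.π (fun _ : Unit => c) ()
  reindex σ c _ p := (Pi.reindex σ c).hom ≫ p
  comp {_ _ J _ _ _ b} p q :=
    Pi.lift (fun i => Pi.lift (fun j : J i =>
      Pi.π (fun x : Σ i, J i => b x.1 x.2) ⟨i, j⟩) ≫ q i) ≫ p
  reindex_refl {I _ c _} p := by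
    have h : (Pi.reindex (Equiv.refl I) c).hom = 𝟙 (∏ᶜ c) :=
      Pi.hom_ext _ _ fun i => (Pi.reindex_hom_π (Equiv.refl I) c i).trans (Category.id_comp _).symm
    exact (congrArg (· ≫ p) h).trans (Category.id_comp p)
  reindex_trans {I I' I'' _ _ _} σ τ {c _} p := by
    have h : (Pi.reindex (σ.trans τ) c).hom =
        (Pi.reindex σ (c ∘ τ)).hom ≫ (Pi.reindex τ c).hom := by
      refine pi_hom_ext_equiv (σ.trans τ) fun i => ?_
      refine (Pi.reindex_hom_π (σ.trans τ) c i).trans (Eq.trans ?_ (Category.assoc _ _ _).symm)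
      refine Eq.trans ?_ (congrArg (_ ≫ ·) (Pi.reindex_hom_π τ c (σ i))).symm
      exact (Pi.reindex_hom_π σ (c ∘ τ) i).symm
    exact (congrArg (· ≫ p) h).trans (Category.assoc _ _ _)
  comp_reindex_left {I I' _ _} σ {J _ c d b} p q := by
    refine Eq.trans (Category.assoc _ _ _).symm (Eq.trans ?_ (Category.assoc _ _ _))
    refine congrArg (· ≫ p) (pi_hom_ext_equiv σ fun i => ?_)
    refine Eq.trans (Category.assoc _ _ _) (Eq.trans ?_ (Category.assoc _ _ _).symm)
    refine Eq.trans (congrArg (_ ≫ ·) (Pi.reindex_hom_π σ c i)) ?_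
    refine Eq.trans (Pi.lift_π _ _) (Eq.trans ?_ (congrArg (_ ≫ ·) (Pi.lift_π _ _)).symm)
    refine Eq.trans ?_ (Category.assoc _ _ _)
    refine congrArg (· ≫ q (σ i)) (Pi.hom_ext _ _ fun j => ?_)
    refine Eq.trans (Pi.lift_π _ _) (Eq.trans ?_ (Category.assoc _ _ _).symm)
    refine Eq.trans ?_ (congrArg (_ ≫ ·) (Pi.lift_π _ _)).symm
    exact (Pi.reindex_hom_π (Equiv.sigmaCongrLeft (β := J) σ)
      (fun x : Σ i, J i => b x.1 x.2) ⟨i, j⟩).symm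
  comp_reindex_right {I _ J J' _ _} τ {c d b} p q := by
    refine Eq.trans ?_ (Category.assoc _ _ _)
    refine congrArg (· ≫ p) (Pi.hom_ext _ _ fun i => ?_)
    refine Eq.trans (Pi.lift_π _ _) (Eq.trans ?_ (Category.assoc _ _ _).symm)
    refine Eq.trans ?_ (congrArg (_ ≫ ·) (Pi.lift_π _ _)).symm
    refine Eq.trans (Category.assoc _ _ _).symm (Eq.trans ?_ (Category.assoc _ _ _))
    refine congrArg (· ≫ q i) (pi_hom_ext_equiv (τ i) fun j => ?_)
    refine Eq.trans (Category.assoc _ _ _) (Eq.trans ?_ (Category.assoc _ _ _).symm)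
    refine Eq.trans (congrArg (_ ≫ ·) (Pi.reindex_hom_π (τ i) (b i) j)) ?_
    refine Eq.trans (Pi.lift_π _ _) (Eq.trans ?_ (congrArg (_ ≫ ·) (Pi.lift_π _ _)).symm)
    exact (Pi.reindex_hom_π (Equiv.sigmaCongrRight τ)
      (fun x : Σ i, J' i => b x.1 x.2) ⟨i, j⟩).symm
  unit_comp {I _ c d} p := by
    rw [Pi.lift_π]
    congr 1
    refine Pi.hom_ext _ _ fun i => ?_
    rw [Pi.lift_π]
    exact (Pi.reindex_hom_π (Equiv.uniqueSigma fun _ : Unit => I) c ⟨(), i⟩).symm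
  comp_unit {I _ c d} p := by
    congr 1
    refine Pi.hom_ext _ _ fun i => ?_
    rw [Pi.lift_π, Pi.lift_π]
    exact (Pi.reindex_hom_π (Equiv.sigmaUnique I fun _ => Unit) c ⟨i, ()⟩).symm
  assoc {I _ J _ K _ c d b a} p q r := by
    refine Eq.trans (Category.assoc _ _ _).symm (Eq.trans ?_ (Category.assoc _ _ _))
    refine congrArg (· ≫ p) (Pi.hom_ext _ _ fun i => ?_)
    refine Eq.trans (Category.assoc _ _ _) (Eq.trans ?_ (Category.assoc _ _ _).symm)
    refine Eq.trans (congrArg (_ ≫ ·) (Pi.lift_π _ _)) ?_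
    refine Eq.trans ?_ (congrArg (_ ≫ ·) (Pi.lift_π _ _)).symm
    refine Eq.trans (Category.assoc _ _ _).symm (Eq.trans ?_ (Category.assoc _ _ _))
    refine Eq.trans ?_ (Category.assoc _ _ _)
    refine congrArg (· ≫ q i) (Pi.hom_ext _ _ fun j => ?_)
    refine Eq.trans (Category.assoc _ _ _) (Eq.trans ?_ (Category.assoc _ _ _).symm)
    refine Eq.trans (congrArg (_ ≫ ·) (Pi.lift_π _ _)) ?_
    refine Eq.trans (Pi.lift_π _ _) (Eq.trans ?_ (congrArg (_ ≫ ·) (Pi.lift_π _ _)).symm)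
    refine Eq.trans ?_ (Category.assoc _ _ _)
    refine congrArg (· ≫ r i j) (Pi.hom_ext _ _ fun k => ?_)
    refine Eq.trans (Pi.lift_π _ _) (Eq.trans ?_ (Category.assoc _ _ _).symm)
    refine Eq.trans ?_ (congrArg (_ ≫ ·) (Pi.lift_π _ _)).symm
    refine Eq.trans ?_ (Category.assoc _ _ _).symm
    refine Eq.trans ?_ (whisker_eq _ (Pi.lift_π (fun y : Σ j, K i j =>
      Pi.π (fun x : Σ i, Σ j, K i j => a x.1 x.2.1 x.2.2) ⟨i, y⟩) ⟨j, k⟩)).symm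
    exact (Pi.reindex_hom_π (Equiv.sigmaAssoc K)
      (fun x : Σ i, Σ j, K i j => a x.1 x.2.1 x.2.2) ⟨⟨i, j⟩, k⟩).symm

end Cartesian

section Grothendieck

variable {S : Type u} [Category.{v} S] [HasFiniteProducts S]

/-- The object of `S` by which a dendrex `t` of the nerve of `S` labels an edge. -/
noncomputable def label {T : OpTree} (t : OperadHom T.operad (cartesianOperad S)) (a : T.Edge) : S :=
  t.colour a

/-- The arrow of `S` which a dendrex `t` of the nerve of `S` associates to an operation of
`Ω(T)`. -/
noncomputable def arrow {T : OpTree} (t : OperadHom T.operad (cartesianOperad S)) {I : Type} [Finite I]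
    {c : I → T.Edge} {a : T.Edge} (h : T.Gen c a) : (∏ᶜ fun i => label t (c i)) ⟶ label t a :=
  t.map (PLift.up h)

/-- The object `in(t)` of a dendrex `t` of the nerve of `S`: the product of the objects by which
the leaves are labelled. -/
noncomputable def inObj {T : OpTree} (t : OperadHom T.operad (cartesianOperad S)) : S :=
  ∏ᶜ fun l : T.Leaf => label t l.1

/-- Pulling back a dendrex of the nerve of `S` along a morphism of trees. -/
noncomputable def pull {R T : OpTree} (α : R ⟶ T)
    (t : OperadHom T.operad (cartesianOperad S)) : OperadHom R.operad (cartesianOperad S) :=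
  (OpTree.operadHom α).comp t

/-- The canonical arrow `in(α) : in(t) ⟶ in(α^* t)` of a morphism of trees `α : R ⟶ T`.  Its
component at a leaf `l` of `R` is the projection to the leaves of `T` above the edge `α(l)`,
followed by the arrow which `t` associates to the subtree of `T` above `α(l)`.  (If `α(l)` is a
leaf, this is just the projection to the factor `α(l)`.) -/
noncomputable def inMap {R T : OpTree} (α : R ⟶ T)
    (t : OperadHom T.operad (cartesianOperad S)) : inObj t ⟶ inObj (pull α t) :=
  Pi.lift fun l : R.Leaf =>
    Pi.lift (fun m : T.LeafAbove (α.1 l.1) =>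
      Pi.π (fun l : T.Leaf => label t l.1) ⟨m.1, m.2.1⟩) ≫
    arrow t (OpTree.gen_leafAbove (α.1 l.1))

/-- The dendrices of shape `T` of the Grothendieck construction `∫_S X`. -/
structure GrothendieckDendrex (X : Sᵒᵖ ⥤ DSet.{w}) (T : OpTree) where
  /-- a dendrex of the nerve of `S` -/
  t : OperadHom T.operad (cartesianOperad S)
  /-- a map of collections `x : Ω[T] → ∐ X(S)` with `x(r) ∈ X(in(r^* t))` -/
  x {R : OpTree} (r : R ⟶ T) : (X.obj (op (inObj (pull r t)))).obj (op R)
  compat {R U : OpTree} (r : R ⟶ T) (α : U ⟶ R) :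
    (X.obj (op (inObj (pull r t)))).map α.op (x r) =
      (X.map (inMap α (pull r t)).op).app (op U) (x (α ≫ r))

/-- The dendroidal Grothendieck construction `∫_S X` of a diagram of dendroidal sets. -/
noncomputable def grothendieck (X : Sᵒᵖ ⥤ DSet.{w}) : DSet.{max 1 u v w} where
  obj T := GrothendieckDendrex X T.unop
  map β := ↾fun y =>
    { t := pull β.unop y.t
      x := fun r => y.x (r ≫ β.unop)
      compat := fun r α => y.compat (r ≫ β.unop) α }

end Grothendieck

end Dendroidal

/-! A dendrex of `∫_S X` consists of a dendrex `t` of the nerve of `S` and compatible values `x(r)`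
over the objects `in(r^* t)`. A horn in `∫_S X` is therefore filled in two stages: first in the
nerve, then in the single dendroidal set `X(in(t))`.

The nerve is a strict inner Kan complex (`nerve_horn_exists`, `nerve_horn_unique`). Since `Ω(T)` is
free on the vertices of `T`, a dendrex of the nerve is a labelling of the edges together with an
arbitrary arrow for every vertex. When `T` has an inner edge `e`, all its edges and all the corollas
of its vertices belong to the horn, so the horn determines these data and no condition remains to be
met at `∂_e`.

Once `t` is known, transport along the arrows `in(r) : in(t) ⟶ in(r^* t)` turns the values of the
given family into a horn in `X(in(t))`; this needs the functoriality of `in` (`inMap_comp`). Let `z`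
fill it. A value `x(r)` outside the horn must then satisfy `X(in(r))(x(r)) = r^* z`. This equation
has exactly one solution: a morphism which does not send the root to the root and leaves to leaves
factors through an outer face (`factors_of_not_isFull`), so a morphism `r` outside the horn is full,
hence bijective on leaves, and `in(r)` is invertible (`isIso_inMap`). Compatibility at such an `r`
can be checked after transport to `X(in(t))`, where it is the functoriality of `z`.

For uniqueness, `t` is determined by the nerve, the value at the identity by strictness of
`X(in(t))`, and the remaining values by the invertibility of `in(r)`.

The combinatorics of trees rests on one description of operations: `c` is the family of inputs of an
operation with output `d` exactly if it is an antichain of edges above `d` such that every leaf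
above `d` is above some `c i`. -/

namespace Dendroidal

namespace OpTree

variable {T R : OpTree}

/-! ### Operations of `Ω(T)` as cuts of `T` -/

theorem Above.antisymm {a b : T.Edge} (h : T.Above a b) (h' : T.Above b a) : a = b := by
  rcases Relation.ReflTransGen.cases_head h with e | ⟨c, hc, hcb⟩
  · exact e
  · exact absurd (Relation.TransGen.head' hc (hcb.trans h')) (T.acyclic a)

theorem Above.total {a b c : T.Edge} (h : T.Above a b) (h' : T.Above a c) :
    T.Above b c ∨ T.Above c b :=
  Relation.ReflTransGen.total_of_right_unique Step.rightUnique h h'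

theorem IsLeaf.eq_of_above {l a : T.Edge} (hl : T.IsLeaf l) (h : T.Above a l) : a = l := by
  rcases Relation.ReflTransGen.cases_tail h with e | ⟨c, _, ⟨_, hc⟩⟩
  · exact e.symm
  · exact absurd hc (hl _)

theorem exists_out_of_not_isLeaf {a : T.Edge} (h : ¬ T.IsLeaf a) : ∃ v, T.out v = a := by
  simpa [IsLeaf] using h

theorem Above.exists_input {a : T.Edge} {v : T.Vertex} (h : T.Above a (T.out v))
    (hne : a ≠ T.out v) : ∃ b, T.IsInput v b ∧ T.Above a b := by
  rcases Relation.ReflTransGen.cases_tail h with e | ⟨b, hab, hb⟩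
  · exact absurd e.symm hne
  · exact ⟨b, hb.isInput, hab⟩

theorem Gen.above {I : Type} {c : I → T.Edge} {d : T.Edge} (h : T.Gen c d) (i : I) :
    T.Above (c i) d := by
  induction h with
  | unit a => exact .refl
  | vertex v => exact .single i.2.step
  | reindex σ _ ih => exact ih _
  | comp _ _ ih ih' => exact (ih' i.1 i.2).trans (ih i.1)

theorem Gen.antichain {I : Type} {c : I → T.Edge} {d : T.Edge} (h : T.Gen c d) {i j : I}
    (hij : T.Above (c i) (c j)) : i = j := by
  induction h with
  | unit a => rfl
  | vertex v => exact Subtype.ext (IsInput.unique i.2 j.2 .refl hij)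
  | reindex σ _ ih => exact σ.injective (ih hij)
  | comp _ h' ih ih' =>
    obtain ⟨i, k⟩ := i
    obtain ⟨j, l⟩ := j
    obtain rfl : i = j := by
      rcases Above.total ((h' i).above k) (hij.trans ((h' j).above l)) with h | h
      · exact ih h
      · exact (ih h).symm
    obtain rfl := ih' i hij
    rfl

theorem Gen.cover {I : Type} {c : I → T.Edge} {d : T.Edge} (h : T.Gen c d) {l : T.Edge}
    (hl : T.IsLeaf l) (hd : T.Above l d) : ∃ i, T.Above l (c i) := by
  induction h with
  | unit a => exact ⟨(), hd⟩
  | vertex v =>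
    obtain ⟨b, hb, hlb⟩ := hd.exists_input fun h => hl v h.symm
    exact ⟨⟨b, hb⟩, hlb⟩
  | reindex σ _ ih =>
    obtain ⟨i, hi⟩ := ih hd
    obtain ⟨i, rfl⟩ := σ.surjective i
    exact ⟨i, hi⟩
  | comp _ _ ih ih' =>
    obtain ⟨i, hi⟩ := ih hd
    obtain ⟨j, hj⟩ := ih' i hi
    exact ⟨⟨i, j⟩, hj⟩

/-- A family of edges above `d` which is an antichain and below all leaves above `d` is the family
of inputs of an operation with output `d`. -/
theorem gen_of_cover (d : T.Edge) : ∀ {I : Type} (c : I → T.Edge),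
    (∀ i j, T.Above (c i) (c j) → i = j) → (∀ i, T.Above (c i) d) →
    (∀ l, T.IsLeaf l → T.Above l d → ∃ i, T.Above l (c i)) → T.Gen c d := by
  induction d using T.wellFounded_step.induction with
  | _ d ih =>
  intro I c hanti habove hcover
  by_cases hd : ∃ i, c i = d
  · obtain ⟨i, rfl⟩ := hd
    have huniq : ∀ j, j = i := fun j => hanti j i (habove j)
    let σ : I ≃ Unit :=
      { toFun := fun _ => ()
        invFun := fun _ => i
        left_inv := fun j => (huniq j).symm
        right_inv := fun _ => rfl }
    have h := Gen.reindex σ (Gen.unit (c i))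
    have e : c = fun _ => c i := funext fun j => congrArg c (huniq j)
    rw [e]
    exact h
  · have hleaf : ¬ T.IsLeaf d := fun hl => by
      obtain ⟨i, hi⟩ := hcover d hl .refl
      exact hd ⟨i, (habove i).antisymm hi⟩
    obtain ⟨v, rfl⟩ := exists_out_of_not_isLeaf hleaf
    -- The cut avoids `d`, so it splits into cuts of the subtrees above the inputs of `v`, to which
    -- induction applies.
    have hex : ∀ i, ∃ b : T.Input v, T.Above (c i) b.1 := fun i => by
      obtain ⟨b, hb, hib⟩ := (habove i).exists_input fun h => hd ⟨i, h⟩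
      exact ⟨⟨b, hb⟩, hib⟩
    choose g hg using hex
    refine Gen.reindex (Equiv.sigmaFiberEquiv g).symm
      (Gen.comp (J := fun b => {i // g i = b}) (b := fun _ i => c i.1) (Gen.vertex v) fun b => ?_)
    refine ih b.1 b.2.step _ (fun i j h => Subtype.ext (hanti _ _ h)) ?_ ?_
    · rintro ⟨i, rfl⟩
      exact hg i
    · intro l hl hlb
      obtain ⟨i, hi⟩ := hcover l hl (hlb.tail b.2.step)
      exact ⟨⟨i, Subtype.ext (IsInput.unique (g i).2 b.2 (hi.trans (hg i)) hlb)⟩, hi⟩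

/-! ### Morphisms of trees and the order of edges -/

theorem above_map (f : R ⟶ T) {a b : R.Edge} (h : R.Above a b) : T.Above (f.1 a) (f.1 b) := by
  induction h with
  | refl => exact .refl
  | tail _ hbc ih =>
    obtain ⟨hb, rfl⟩ := hbc
    exact ih.trans ((f.2 (Gen.vertex _)).above ⟨_, hb, rfl⟩)

/-- Two incomparable edges have paths to the root which first meet at a vertex, entering it through
different inputs. -/
theorem above_or_exists_vertex (a b : T.Edge) : T.Above a b ∨ T.Above b a ∨
    ∃ (v : T.Vertex) (a' b' : T.Input v), a' ≠ b' ∧ T.Above a a'.1 ∧ T.Above b b'.1 := by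
  induction T.above_root a using Relation.ReflTransGen.head_induction_on with
  | refl => exact Or.inr (Or.inl (T.above_root b))
  | @head a c hac _ ih =>
    rcases ih with h | h | ⟨v, a', b', hne, ha, hb⟩
    · exact Or.inl (.head hac h)
    · obtain ⟨ha, rfl⟩ := hac
      by_cases hb : b = T.out (T.below a ha)
      · exact Or.inl (.single ⟨ha, hb.symm⟩)
      · obtain ⟨b', hb', hbb'⟩ := h.exists_input hb
        by_cases hab : b' = a
        · exact Or.inr (Or.inl (hab ▸ hbb'))
        · exact Or.inr (Or.inr ⟨_, ⟨a, ha, rfl⟩, ⟨b', hb'⟩,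
            fun h => hab (congrArg Subtype.val h).symm, .refl, hbb'⟩)
    · exact Or.inr (Or.inr ⟨v, a', b', hne, .head hac ha, hb⟩)

/-- If `a` and `b` were incomparable, they would be above different inputs of a vertex of `R`. The
images of these inputs form an antichain, yet both lie on the path from `z` to the root. -/
theorem comparable_of_above_map (f : R ⟶ T) {a b : R.Edge} {z : T.Edge}
    (ha : T.Above z (f.1 a)) (hb : T.Above z (f.1 b)) : R.Above a b ∨ R.Above b a := by
  rcases above_or_exists_vertex a b with h | h | ⟨v, a', b', hne, haa', hbb'⟩
  · exact Or.inl h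
  · exact Or.inr h
  · refine absurd ?_ hne
    have h := f.2 (Gen.vertex v)
    rcases Above.total (ha.trans (above_map f haa')) (hb.trans (above_map f hbb')) with h' | h'
    · exact h.antichain h'
    · exact (h.antichain h').symm

/-! ### Factorization through outer faces -/

/-- Climbing through inputs which are not leaves must stop, as the tree is finite. The vertex
reached may have no inputs at all. It is a candidate for pruning as soon as its output is not the
root. -/
theorem exists_top_vertex (a : T.Edge) (ha : ¬ T.IsLeaf a) :
    ∃ w, T.Above (T.out w) a ∧ ∀ x, T.IsInput w x → T.IsLeaf x := by
  induction a using T.wellFounded_step.induction with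
  | _ a ih =>
  obtain ⟨v, rfl⟩ := exists_out_of_not_isLeaf ha
  by_cases h : ∀ x, T.IsInput v x → T.IsLeaf x
  · exact ⟨v, .refl, h⟩
  · push Not at h
    obtain ⟨x, hx, hx'⟩ := h
    obtain ⟨w, hw, hw'⟩ := ih x hx.step hx'
    exact ⟨w, hw.tail hx.step, hw'⟩

/-- A vertex whose output is not the root and whose inputs are leaves, as an outer vertex. -/
theorem isOuterVertex_of_top {w : T.Vertex} (hr : T.out w ≠ T.root)
    (hw : ∀ x, T.IsInput w x → T.IsLeaf x) : ∃! a, T.IsAttached w a ∧ T.IsInner a := by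
  refine ⟨T.out w, ⟨Or.inl rfl, hr, fun h => h w rfl⟩, ?_⟩
  rintro a ⟨h | h, h'⟩
  · exact h.symm
  · exact absurd (hw a h) h'.2

theorem above_of_prune_above {w : T.OuterVertex} {a b : (T.prune w).Edge}
    (h : (T.prune w).Above a b) : T.Above a.1 b.1 :=
  above_map (pruneMap w) h

theorem prune_above_of_above {w : T.OuterVertex} {a b : T.Edge} (h : T.Above a b)
    (ha : T.Remains w a) (hb : T.Remains w b) : (T.prune w).Above ⟨a, ha⟩ ⟨b, hb⟩ := by
  -- When the root vertex is deleted, a path in `T/w` ends at the new root, where no further step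
  -- down exists. A remaining edge `b` below the new root must then be equal to it.
  have hroot : ∀ {a : T.Edge} (ha : T.Remains w a), T.Above a b →
      (⟨a, ha⟩ : {a // T.Remains w a}) = pruneRoot w → (T.prune w).Above ⟨a, ha⟩ ⟨b, hb⟩ := by
    intro a ha h hp
    have h' : T.Above b a := by
      have := above_of_prune_above ((T.prune w).above_root ⟨b, hb⟩)
      rw [show (T.prune w).root = ⟨a, ha⟩ from hp.symm] at this
      exact this
    obtain rfl := h.antisymm h'
    exact .refl
  induction h using Relation.ReflTransGen.head_induction_on with
  | refl => exact .refl
  | @head a c hac hcb ih =>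
    by_cases hp : (⟨a, ha⟩ : {a // T.Remains w a}) = pruneRoot w
    · exact hroot ha (.head hac hcb) hp
    · obtain ⟨h', rfl⟩ := hac
      exact .head ⟨hp, rfl⟩ (ih (remains_out w (below_ne_of_ne_pruneRoot w hp)))

/-- A morphism into `T` factors through the outer face `∂_w` if its image contains neither the
outer edges at `w` nor the vertex `w`. -/
theorem factors_pruneMap (w : T.OuterVertex) (r : R ⟶ T) (hr : ∀ a, T.Remains w (r.1 a))
    (hw : ∀ v, T.Above (T.out w.1) (r.1 (R.out v)) →
      ∃ a, R.IsInput v a ∧ T.Above (T.out w.1) (r.1 a)) :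
    ∃ g : R ⟶ T.prune w, r = g ≫ pruneMap w := by
  refine ⟨homMk (fun a => ⟨r.1 a, hr a⟩) fun v => ?_, rfl⟩
  have h := r.2 (Gen.vertex v)
  refine gen_of_cover _ _ (fun i j hij => h.antichain (above_of_prune_above hij))
    (fun i => prune_above_of_above (h.above i) _ _) ?_
  rintro ⟨l, hl⟩ hleaf hlv
  have hlv' : T.Above l (r.1 (R.out v)) := above_of_prune_above hlv
  -- A leaf of `T/w` is either a leaf of `T` or the output of the deleted vertex; the second case is
  -- what `hw` is for.
  by_cases hl' : T.IsLeaf l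
  · obtain ⟨i, hi⟩ := h.cover hl' hlv'
    exact ⟨i, prune_above_of_above hi _ _⟩
  · obtain ⟨w', rfl⟩ := exists_out_of_not_isLeaf hl'
    by_cases hww' : w' = w.1
    · subst hww'
      obtain ⟨a, ha, ha'⟩ := hw v hlv'
      exact ⟨⟨a, ha⟩, prune_above_of_above ha' _ _⟩
    · exact absurd rfl (hleaf ⟨w', hww'⟩)

/-- A morphism of trees is full if it sends the root to the root and leaves to leaves. -/
def IsFull (r : R ⟶ T) : Prop := r.1 R.root = T.root ∧ ∀ l, R.IsLeaf l → T.IsLeaf (r.1 l)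

/-- The image of `r` lies above a single input `b'` of the root vertex. If another input is not a
leaf, a top vertex above it can be pruned; otherwise `b'` is the only inner edge at the root vertex,
which can itself be pruned. -/
theorem factors_of_root_ne (e : T.InnerEdge) (r : R ⟶ T) (h : r.1 R.root ≠ T.root) :
    ∃ (w : T.OuterVertex) (g : R ⟶ T.prune w), r = g ≫ pruneMap w := by
  have habove : ∀ a, T.Above (r.1 a) (r.1 R.root) := fun a => above_map r (R.above_root a)
  have hne : ∀ a, r.1 a ≠ T.root := fun a ha =>
    h ((ha ▸ habove a : T.Above T.root (r.1 R.root)).antisymm (T.above_root _)).symm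
  have hroot : ¬ T.IsLeaf T.root := fun hl => e.2.1 (hl.eq_of_above (T.above_root _))
  obtain ⟨w₀, hw₀⟩ := exists_out_of_not_isLeaf hroot
  have hinput : ∀ a, a ≠ T.root → ∃ b, T.IsInput w₀ b ∧ T.Above a b := fun a ha =>
    (hw₀ ▸ T.above_root a : T.Above a (T.out w₀)).exists_input (hw₀ ▸ ha)
  obtain ⟨b', hb', hrb'⟩ := hinput _ h
  have hinner : ∀ b, T.IsInput w₀ b → ¬ T.IsLeaf b → T.IsInner b := fun b hb hl =>
    ⟨fun h => hb.ne_out (h.trans hw₀.symm), hl⟩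
  by_cases hb : ∃ b, T.IsInput w₀ b ∧ ¬ T.IsLeaf b ∧ b ≠ b'
  · obtain ⟨b, hb, hbl, hbb'⟩ := hb
    obtain ⟨w, hwb, hw⟩ := exists_top_vertex b hbl
    have hwr : T.out w ≠ T.root := fun hwr =>
      (hinner b hb hbl).1 ((hwr ▸ hwb : T.Above T.root b).antisymm (T.above_root b)).symm
    have hnot : ∀ x, T.Above x b → ¬ T.Above x (r.1 R.root) := fun x hx hx' =>
      hbb' (IsInput.unique hb hb' hx (hx'.trans hrb'))
    refine ⟨⟨w, isOuterVertex_of_top hwr hw⟩, factors_pruneMap _ r ?_ ?_⟩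
    · rintro a (ha | ha)
      · exact ⟨hne a, fun hl => hl w ha⟩
      · exact absurd (habove a) (hnot _ (.head ha.step hwb))
    · intro v hv
      exact absurd (hv.trans (habove _)) (hnot _ hwb)
  · push Not at hb
    -- The inner edge `e` lies above some input of the root vertex. That input is not a leaf, and by
    -- `hb` it can only be `b'`.
    have hb'l : ¬ T.IsLeaf b' := fun hl => by
      obtain ⟨b, hb₁, hb₂⟩ := hinput e.1 e.2.1
      by_cases hbl : T.IsLeaf b
      · exact e.2.2 (hbl.eq_of_above hb₂ ▸ hbl)
      · exact hbl (hb b hb₁ hbl ▸ hl)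
    have hw : ∃! a, T.IsAttached w₀ a ∧ T.IsInner a := by
      refine ⟨b', ⟨Or.inr hb', hinner b' hb' hb'l⟩, ?_⟩
      rintro a ⟨ha | ha, hai⟩
      · exact absurd (ha.symm.trans hw₀) hai.1
      · exact hb a ha hai.2
    refine ⟨⟨w₀, hw⟩, factors_pruneMap _ r ?_ ?_⟩
    · rintro a (ha | ha)
      · exact absurd (ha.symm.trans hw₀) (hne a)
      · have : r.1 a = b' := IsInput.unique ha hb' .refl ((habove a).trans hrb')
        rw [this]
        exact hinner b' hb' hb'l
    · intro v hv
      change T.Above (T.out w₀) _ at hv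
      rw [hw₀] at hv
      exact absurd (hv.antisymm (T.above_root _)).symm (hne _)

/-- Nothing of `R` is above `k`, so the image of `r` has nothing strictly above `r(k)`, and a top
vertex above `r(k)` can be pruned. -/
theorem factors_of_not_isLeaf (e : T.InnerEdge) (r : R ⟶ T) {k : R.Edge} (hk : R.IsLeaf k)
    (h : ¬ T.IsLeaf (r.1 k)) :
    ∃ (w : T.OuterVertex) (g : R ⟶ T.prune w), r = g ≫ pruneMap w := by
  obtain ⟨w, hwr, hwk, hw⟩ : ∃ w, T.out w ≠ T.root ∧ T.Above (T.out w) (r.1 k) ∧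
      ∀ x, T.IsInput w x → T.IsLeaf x := by
    have key : ∀ a, a ≠ T.root → ¬ T.IsLeaf a → T.Above a (r.1 k) → ∃ w, T.out w ≠ T.root ∧
        T.Above (T.out w) (r.1 k) ∧ ∀ x, T.IsInput w x → T.IsLeaf x := by
      intro a ha hal hak
      obtain ⟨w, hwa, hw⟩ := exists_top_vertex a hal
      exact ⟨w, fun hwr => ha ((hwr ▸ hwa : T.Above T.root a).antisymm (T.above_root a)).symm,
        hwa.trans hak, hw⟩
    -- The output of the pruned vertex must not be the root. If `r(k)` is the root, the climb starts
    -- at `e` instead.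
    by_cases hkr : r.1 k = T.root
    · exact key e.1 e.2.1 e.2.2 (hkr ▸ T.above_root _)
    · exact key _ hkr h .refl
  refine ⟨⟨w, isOuterVertex_of_top hwr hw⟩, factors_pruneMap _ r ?_ ?_⟩
  · rintro a (ha | ha)
    · rw [← ha]
      exact ⟨hwr, fun hl => hl w rfl⟩
    · have hak : T.Above (r.1 a) (r.1 k) := .head ha.step hwk
      have hka : T.Above (r.1 k) (r.1 a) := by
        rcases comparable_of_above_map r .refl hak with h' | h'
        · rw [hk.eq_of_above h']
          exact .refl
        · exact above_map r h'
      have hwa : T.Above (T.out w) (r.1 a) := hwk.trans hka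
      exact absurd (hwa.antisymm (.single ha.step)).symm ha.ne_out
  · intro v hv
    rcases comparable_of_above_map r hwk hv with h' | h'
    · obtain ⟨a, ha, hka⟩ := h'.exists_input fun h => hk v h.symm
      exact ⟨a, ha, hwk.trans (above_map r hka)⟩
    · exact absurd (hk.eq_of_above h') (hk v)

/-- If `T` has an inner edge, a morphism into `T` which is not full factors through an outer
face. -/
theorem factors_of_not_isFull (e : T.InnerEdge) (r : R ⟶ T) (h : ¬ IsFull r) :
    ∃ (w : T.OuterVertex) (g : R ⟶ T.prune w), r = g ≫ pruneMap w := by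
  by_cases hr : r.1 R.root = T.root
  · have : ∃ l, R.IsLeaf l ∧ ¬ T.IsLeaf (r.1 l) := by
      by_contra h'
      push Not at h'
      exact h ⟨hr, h'⟩
    obtain ⟨l, hl, hl'⟩ := this
    exact factors_of_not_isLeaf e r hl hl'
  · exact factors_of_root_ne e r hr

/-- The map on leaves induced by a full morphism. -/
def IsFull.leafMap {r : R ⟶ T} (h : IsFull r) (l : R.Leaf) : T.Leaf := ⟨r.1 l.1, h.2 l.1 l.2⟩

/-- Leaves with the same image are comparable, hence equal. The image of the operation given by the
whole of `R` is an operation with output the root of `T`, so its inputs, being leaves, exhaust the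
leaves of `T`. -/
theorem IsFull.leafMap_bijective {r : R ⟶ T} (h : IsFull r) :
    Function.Bijective h.leafMap := by
  constructor
  · intro l l' hll'
    have hll'' : r.1 l.1 = r.1 l'.1 := congrArg Subtype.val hll'
    rcases comparable_of_above_map r (z := r.1 l.1) Relation.ReflTransGen.refl
      (by rw [← hll'']; exact .refl) with h' | h'
    · exact Subtype.ext (l'.2.eq_of_above h')
    · exact Subtype.ext (l.2.eq_of_above h').symm
  · rintro ⟨m, hm⟩
    have hgen := r.2 (R.gen_leafAbove R.root)
    obtain ⟨l, hl⟩ := hgen.cover hm (h.1 ▸ T.above_root m)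
    exact ⟨⟨l.1, l.2.1⟩, Subtype.ext ((h.2 _ l.2.1).eq_of_above hl).symm⟩

/-! ### Horns -/

/-- A morphism belongs to the horn `Λ^e[T]` if it factors through a face other than `∂_e`. -/
def InHorn (e : T.InnerEdge) (r : R ⟶ T) : Prop :=
  ∃ (F : T.Face) (_ : F ≠ .inner e) (g : R ⟶ F.source), r = g ≫ F.map

theorem InHorn.precomp {e : T.InnerEdge} {r : R ⟶ T} (h : InHorn e r) {U : OpTree} (α : U ⟶ R) :
    InHorn e (α ≫ r) := by
  obtain ⟨F, hF, g, rfl⟩ := h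
  exact ⟨F, hF, α ≫ g, rfl⟩

theorem inHorn_face {e : T.InnerEdge} {F : T.Face} (hF : F ≠ .inner e) : InHorn e F.map :=
  ⟨F, hF, 𝟙 _, rfl⟩

theorem inHorn_pruneMap (e : T.InnerEdge) (w : T.OuterVertex) : InHorn e (pruneMap w) :=
  inHorn_face (F := .outer w) (by simp)

theorem inHorn_of_not_isFull (e : T.InnerEdge) (r : R ⟶ T) (h : ¬ IsFull r) : InHorn e r := by
  obtain ⟨w, g, rfl⟩ := factors_of_not_isFull e r h
  exact (inHorn_pruneMap e w).precomp g

/-- A morphism is not full if an inner edge of its target lies above the image of a leaf. -/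
theorem not_isFull_of_above (e : T.InnerEdge) (r : R ⟶ T) {l : R.Edge} (hl : R.IsLeaf l)
    (h : T.Above e.1 (r.1 l)) : ¬ IsFull r := fun hr => by
  have hl' := hr.2 l hl
  exact e.2.2 (hl'.eq_of_above h ▸ hl')

/-- The corolla with a given set of leaves. -/
def corolla (J : Type) [Finite J] : OpTree where
  Edge := Option J
  Vertex := Unit
  finite_edge := inferInstance
  root := none
  out _ := none
  out_injective _ _ _ := rfl
  below _ _ := ()
  walk
    | none => .refl
    | some _ => .single ⟨Option.some_ne_none _, rfl⟩

/-! ### Corollas: operations of `Ω(T)` as morphisms into `T` -/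

section corolla

variable {J : Type} [Finite J]

theorem corolla_isLeaf (j : J) : (corolla J).IsLeaf (some j) := fun _ h => by cases h

/-- The inputs of the vertex of a corolla. -/
def corollaInput : (corolla J).Input () ≃ J where
  toFun
    | ⟨some j, _⟩ => j
    | ⟨none, h⟩ => (h.1 rfl).elim
  invFun j := ⟨some j, ⟨Option.some_ne_none j, rfl⟩⟩
  left_inv
    | ⟨some _, _⟩ => rfl
    | ⟨none, h⟩ => (h.1 rfl).elim
  right_inv _ := rfl

theorem corolla_gen : (corolla J).Gen (fun j : J => some j) none :=
  Gen.reindex corollaInput.symm (Gen.vertex (T := corolla J) ())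

/-- The morphism from a corolla to `T` given by an operation of `Ω(T)`. -/
def corollaMap {c : J → T.Edge} {d : T.Edge} (h : T.Gen c d) : corolla J ⟶ T :=
  homMk (fun o => o.elim d c) fun v => by
    have h' := Gen.reindex (corollaInput (J := J)) h
    have e : (fun a : (corolla J).Input v => a.1.elim d c) = fun a => c (corollaInput a) := by
      funext ⟨a, ha⟩
      cases a with
      | none => exact (ha.1 rfl).elim
      | some j => rfl
    rw [e]
    exact h'

theorem corolla_hom_ext {f g : corolla J ⟶ T} (h : f.1 none = g.1 none)
    (h' : ∀ j : J, f.1 (some j) = g.1 (some j)) : f = g :=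
  Subtype.ext <| funext fun
    | none => h
    | some j => h' j

theorem corollaMap_comp {c : J → R.Edge} {d : R.Edge} (h : R.Gen c d) (r : R ⟶ T) :
    corollaMap h ≫ r = corollaMap (r.2 h) :=
  corolla_hom_ext rfl fun _ => rfl

end corolla

theorem not_isFull_edgeMap (e : T.InnerEdge) (a : T.Edge) : ¬ IsFull (edgeMap a) := by
  rintro ⟨h, h'⟩
  have hr : a = T.root := h
  have hl : T.IsLeaf a := h' () fun v => v.elim
  subst hr
  exact e.2.1 (hl.eq_of_above (T.above_root _))

/-- The corolla of an operation with output the root is not full if the inner edge `e` is above one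
of the inputs. -/
theorem not_isFull_corollaMap (e : T.InnerEdge) {J : Type} [Finite J] {c : J → T.Edge}
    {d : T.Edge} (h : T.Gen c d) (he : d = T.root → ∃ j, T.Above e.1 (c j)) :
    ¬ IsFull (corollaMap h) := by
  intro hf
  obtain ⟨j, hj⟩ := he hf.1
  exact not_isFull_of_above e (corollaMap h) (corolla_isLeaf j) hj hf

/-- If the output of `v` is the root, the path down from `e` enters `v` through one of its inputs.
-/
theorem not_isFull_corollaMap_vertex (e : T.InnerEdge) (v : T.Vertex) :
    ¬ IsFull (corollaMap (Gen.vertex v)) :=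
  not_isFull_corollaMap e _ fun hv => by
    obtain ⟨b, hb, heb⟩ := (hv ▸ T.above_root e.1 : T.Above e.1 (T.out v)).exists_input
      fun h => e.2.1 (h.trans hv)
    exact ⟨⟨b, hb⟩, heb⟩

/-- The condition `f ≠ e` is essential: if `T` has only two vertices, the merged vertex of `T/e` is
all of `T`. -/
theorem not_isFull_corollaMap_contract {e f : T.InnerEdge} (hfe : f ≠ e)
    (u : (T.contract f).Vertex) : ¬ IsFull (corollaMap ((contractMap f).2 (Gen.vertex u))) :=
  not_isFull_corollaMap e _ fun hu => by
    have hu' : T.out u.1 = T.root := hu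
    obtain ⟨b, hb, heb⟩ := (hu' ▸ T.above_root e.1 : T.Above e.1 (T.out u.1)).exists_input
      fun h => e.2.1 (h.trans hu')
    -- If the path from `e` enters through `f`, then `e` is strictly above `f`, hence above an input
    -- of the upper of the two merged vertices.
    by_cases hbf : b = f.1
    · subst hbf
      obtain ⟨v, hv⟩ := f.exists_out
      obtain ⟨x, hx, hex⟩ := (hv ▸ heb : T.Above e.1 (T.out v)).exists_input
        fun h => hfe (Subtype.ext (h.trans hv).symm)
      have hxf : T.Step x f.1 := hv ▸ hx.step
      exact ⟨⟨⟨x, fun h => hx.ne_out (h.trans hv.symm)⟩,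
        (contract_isInput_iff f u _).2 (Or.inr ⟨hb, hxf⟩)⟩, hex⟩
    · exact ⟨⟨⟨b, hbf⟩, (contract_isInput_iff f u _).2 (Or.inl hb)⟩, heb⟩

/-- The inputs of a vertex of `T/w` are its inputs in `T`. -/
noncomputable def pruneInput (w : T.OuterVertex) (u : (T.prune w).Vertex) :
    (T.prune w).Input u ≃ T.Input u.1 :=
  Equiv.ofBijective (fun a => ⟨a.1.1, by
      obtain ⟨h, h'⟩ := a.2
      exact ⟨ne_root_of_ne_pruneRoot w h, congrArg Subtype.val h'⟩⟩) <| by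
    constructor
    · intro a b hab
      have : a.1.1 = b.1.1 := congrArg (fun x => x.1) hab
      exact Subtype.ext (Subtype.ext this)
    · rintro ⟨b, hb⟩
      have hr : T.Remains w b := by
        rintro (h | h)
        · exact ⟨hb.1, fun hl => hl _ h⟩
        · obtain ⟨_, hu⟩ := hb
          obtain ⟨_, hw⟩ := h
          exact absurd (hu.symm.trans hw) u.2
      have habove : (T.prune w).Above ⟨b, hr⟩ ((T.prune w).out u) :=
        prune_above_of_above (.single hb.step) _ _
      -- The edge `b` is strictly above the output of `u` in `T/w`, hence above some input `b'` of
      -- `u` there; two comparable inputs of one vertex of `T` agree.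
      obtain ⟨⟨b', hb'r⟩, hb', hbb'⟩ := habove.exists_input fun h =>
        hb.ne_out (congrArg Subtype.val h)
      have hb'u : T.IsInput u.1 b' := by
        obtain ⟨h, h'⟩ := hb'
        exact ⟨ne_root_of_ne_pruneRoot w h, congrArg Subtype.val h'⟩
      exact ⟨⟨⟨b', hb'r⟩, hb'⟩,
        Subtype.ext (IsInput.unique hb hb'u .refl (above_of_prune_above hbb')).symm⟩

end OpTree

end Dendroidal

namespace Dendroidal

open OpTree

/-! ### Maps out of the operad of a tree -/

theorem ColouredOperad.reindex_injective (P : ColouredOperad.{u, v}) {I I' : Type} [Finite I]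
    [Finite I'] (σ : I ≃ I') {c : I' → P.Colour} {d : P.Colour} {p p' : P.Op c d}
    (h : P.reindex σ p = P.reindex σ p') : p = p' := by
  -- The type of `P.reindex ρ p` depends on `ρ`, so `σ.symm.trans σ` is replaced by a variable
  -- before it is identified with the identity.
  have key : ∀ ρ : I' ≃ I', ρ = Equiv.refl I' → P.reindex ρ p = P.reindex ρ p' → p = p' := by
    rintro _ rfl h
    rwa [P.reindex_refl, P.reindex_refl] at h
  refine key (σ.symm.trans σ) σ.symm_trans_self ?_
  rw [P.reindex_trans, P.reindex_trans, h]

theorem OperadHom.ext_vertex {T : OpTree} {P : ColouredOperad.{u, v}} {t t' : OperadHom T.operad P}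
    (hc : t.colour = t'.colour)
    (hv : ∀ v, HEq (t.map (PLift.up (Gen.vertex v))) (t'.map (PLift.up (Gen.vertex v)))) :
    t = t' := by
  obtain ⟨col, m, hu, hr, hm⟩ := t
  obtain ⟨col', m', hu', hr', hm'⟩ := t'
  obtain rfl : col = col' := hc
  suffices key : ∀ {I : Type} {c : I → T.Edge} {d : T.Edge} (h : T.Gen c d) [Finite I],
      m (I := I) (c := c) (d := d) (PLift.up h) = m' (PLift.up h) by
    obtain rfl : @m = @m' := by
      funext I _ c d p
      exact key p.down
    rfl
  intro I c d h
  induction h with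
  | unit a =>
    intro _
    exact (hu a).trans (hu' a).symm
  | vertex v =>
    intro _
    exact eq_of_heq (hv v)
  | reindex σ h ih =>
    intro _
    have := h.finite
    exact (hr σ (PLift.up h)).trans ((congrArg _ ih).trans (hr' σ (PLift.up h)).symm)
  | comp h h' ih ih' =>
    intro _
    have := h.finite
    have := fun i => (h' i).finite
    refine (hm (PLift.up h) fun i => PLift.up (h' i)).trans
      (Eq.trans ?_ (hm' (PLift.up h) fun i => PLift.up (h' i)).symm)
    rw [ih, funext fun i => ih' i]

theorem OperadHom.ext_corolla {J : Type} [Finite J] {P : ColouredOperad.{u, v}}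
    {t t' : OperadHom (corolla J).operad P} (hc : t.colour = t'.colour)
    (h : HEq (t.map (PLift.up corolla_gen)) (t'.map (PLift.up corolla_gen))) : t = t' := by
  refine OperadHom.ext_vertex hc fun v => ?_
  have e : ∀ s : OperadHom (corolla J).operad P, s.map (PLift.up corolla_gen) =
      P.reindex corollaInput.symm (s.map (PLift.up (Gen.vertex (T := corolla J) ()))) := fun s =>
    s.map_reindex corollaInput.symm (PLift.up (Gen.vertex (T := corolla J) ()))
  rw [e t, e t'] at h
  change HEq (t.map (PLift.up (Gen.vertex (T := corolla J) ())))
    (t'.map (PLift.up (Gen.vertex (T := corolla J) ())))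
  generalize t.map (PLift.up (Gen.vertex (T := corolla J) ())) = p at h
  generalize t'.map (PLift.up (Gen.vertex (T := corolla J) ())) = p' at h
  revert p p'
  rw [hc]
  intro p p' h
  exact heq_of_eq (P.reindex_injective _ (eq_of_heq h))

section Cartesian

variable {S : Type u} [Category.{v} S] [HasFiniteProducts S]

theorem ext_of_pull_corolla {T : OpTree} {t t' : OperadHom T.operad (cartesianOperad S)}
    (hc : t.colour = t'.colour)
    (h : ∀ v, pull (corollaMap (Gen.vertex v)) t = pull (corollaMap (Gen.vertex v)) t') :
    t = t' :=
  OperadHom.ext_vertex hc fun v =>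
    congr_arg_heq (fun s : OperadHom (corolla (T.Input v)).operad (cartesianOperad S) =>
      s.map (PLift.up corolla_gen)) (h v)

/-! ### The operad of a tree is free: evaluation in a category with finite products -/

section Eval

variable {T : OpTree} (col : T.Edge → S)
  (τ : ∀ v, (∏ᶜ fun a : T.Input v => col a.1) ⟶ col (T.out v))

/-- `Eval col τ c p b f`: the arrow `f` is the result of evaluating, on the inputs `p`, the
operation with inputs `c` and output `b` by means of the arrows `τ v` assigned to the vertices. -/
inductive Eval {I : Type} (c : I → T.Edge) {A : S} (p : ∀ i, A ⟶ col (c i)) :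
    (b : T.Edge) → (A ⟶ col b) → Prop
  | proj (i : I) : Eval c p (c i) (p i)
  | vertex (v : T.Vertex) (hv : ∀ i, c i ≠ T.out v) (g : ∀ a : T.Input v, A ⟶ col a.1)
      (hg : ∀ a, Eval c p a.1 (g a)) : Eval c p (T.out v) (Pi.lift g ≫ τ v)

variable {col τ} {I : Type} {c : I → T.Edge} {A : S} {p : ∀ i, A ⟶ col (c i)}

/-- Evaluation is single-valued: the condition `hv` in the rule `vertex` makes the two rules
exclusive, and an edge determines the vertex of which it is the output. The two edges are kept apart
so that the derivations can be analysed by cases. -/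
theorem Eval.heq (hc : Function.Injective c) {b b' : T.Edge} {f : A ⟶ col b} {f' : A ⟶ col b'}
    (h : Eval col τ c p b f) (h' : Eval col τ c p b' f') (hb : b = b') : HEq f f' := by
  induction h generalizing b' with
  | proj i =>
    cases h' with
    | proj j =>
      obtain rfl := hc hb
      rfl
    | vertex v hv _ _ => exact absurd hb (hv i)
  | vertex v hv g hg ih =>
    cases h' with
    | proj j => exact absurd hb.symm (hv j)
    | vertex v' hv' g' hg' =>
      obtain rfl := T.out_injective hb
      obtain rfl : g = g' := funext fun a => eq_of_heq (ih a (hg' a) rfl)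
      rfl

theorem Eval.precomp {B : S} (k : B ⟶ A) {b : T.Edge} {f : A ⟶ col b}
    (h : Eval col τ c p b f) : Eval col τ c (fun i => k ≫ p i) b (k ≫ f) := by
  induction h with
  | proj i => exact .proj i
  | vertex v hv g hg ih =>
    have e : k ≫ Pi.lift g ≫ τ v = Pi.lift (fun a => k ≫ g a) ≫ τ v := by
      rw [← Category.assoc]
      congr 1
      exact Pi.hom_ext _ _ fun a => by simp
    rw [e]
    exact .vertex v hv _ ih

theorem Eval.reindex {I' : Type} (σ : I' ≃ I) {b : T.Edge} {f : A ⟶ col b}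
    (h : Eval col τ c p b f) : Eval col τ (fun i => c (σ i)) (fun i => p (σ i)) b f := by
  induction h with
  | proj i =>
    obtain ⟨i, rfl⟩ := σ.surjective i
    exact .proj (c := fun i => c (σ i)) (p := fun i => p (σ i)) i
  | vertex v hv g hg ih => exact .vertex v (fun i => hv _) g ih

/-- Evaluations are grafted by replacing each projection to `c i` with the evaluation of `c i`. The
condition `hx` keeps `x` from being strictly above the cut `c`, so no new input interferes with the
lower part; since `c` is an antichain, the upper parts do not interfere with each other. -/
theorem Eval.comp {J : I → Type} {b : ∀ i, J i → T.Edge} {q : ∀ i j, A ⟶ col (b i j)}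
    (hc : ∀ i j, T.Above (c i) (c j) → i = j) (hb : ∀ i j, T.Above (b i j) (c i))
    (h' : ∀ i, Eval col τ (b i) (q i) (c i) (p i)) {x : T.Edge} {f : A ⟶ col x}
    (h : Eval col τ c p x f) (hx : ∀ i, T.Above x (c i) → x = c i) :
    Eval col τ (fun y : Σ i, J i => b y.1 y.2) (fun y => q y.1 y.2) x f := by
  have inner : ∀ i {x : T.Edge} {f : A ⟶ col x}, Eval col τ (b i) (q i) x f → T.Above x (c i) →
      Eval col τ (fun y : Σ i, J i => b y.1 y.2) (fun y => q y.1 y.2) x f := by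
    intro i x f h hx
    induction h with
    | proj j =>
      exact .proj (c := fun y : Σ i, J i => b y.1 y.2) (p := fun y => q y.1 y.2) ⟨i, j⟩
    | vertex v hv g hg ih =>
      refine .vertex v ?_ g fun a => ih a (.head a.2.step hx)
      rintro ⟨i', j⟩ e
      have hi' : T.Above (T.out v) (c i') := e ▸ hb i' j
      obtain rfl : i = i' := by
        rcases Above.total hx hi' with h | h
        · exact hc _ _ h
        · exact (hc _ _ h).symm
      exact hv j e
  induction h with
  | proj i => exact inner i (h' i) .refl
  | vertex v hv g hg ih =>
    have hnot : ∀ i, ¬ T.Above (T.out v) (c i) := fun i hi => hv i (hx i hi).symm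
    refine .vertex v ?_ g fun a => ih a fun i hi => ?_
    · rintro ⟨i, j⟩ e
      exact hnot i (e ▸ hb i j)
    · rcases Relation.ReflTransGen.cases_head hi with e | ⟨y, hy, hyi⟩
      · exact e
      · obtain rfl := Step.rightUnique a.2.step hy
        exact absurd hyi (hnot i)

theorem Eval.reindex_π [Finite I] {I' : Type} [Finite I'] (σ : I' ≃ I) {b : T.Edge}
    {f : (∏ᶜ fun i => col (c i)) ⟶ col b} (h : Eval col τ c (Pi.π fun i => col (c i)) b f) :
    Eval col τ (fun i => c (σ i)) (Pi.π fun i => col (c (σ i))) b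
      ((Pi.reindex σ fun i => col (c i)).hom ≫ f) := by
  have h' := (h.precomp (Pi.reindex σ fun i => col (c i)).hom).reindex σ
  have e : (fun i => (Pi.reindex σ fun i => col (c i)).hom ≫ Pi.π (fun i => col (c i)) (σ i)) =
      Pi.π fun i => col (c (σ i)) := funext fun i => Pi.reindex_hom_π σ (fun i => col (c i)) i
  rw [e] at h'
  exact h'

theorem Eval.comp_π [Finite I] {J : I → Type} [∀ i, Finite (J i)] {d : T.Edge}
    {b : ∀ i, J i → T.Edge} (hc : T.Gen c d) (hb : ∀ i, T.Gen (b i) (c i))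
    {f : (∏ᶜ fun i => col (c i)) ⟶ col d} {g : ∀ i, (∏ᶜ fun j => col (b i j)) ⟶ col (c i)}
    (h : Eval col τ c (Pi.π fun i => col (c i)) d f)
    (h' : ∀ i, Eval col τ (b i) (Pi.π fun j => col (b i j)) (c i) (g i)) :
    Eval col τ (fun y : Σ i, J i => b y.1 y.2) (Pi.π fun y : Σ i, J i => col (b y.1 y.2)) d
      (Pi.lift (fun i => Pi.lift (fun j : J i =>
        Pi.π (fun y : Σ i, J i => col (b y.1 y.2)) ⟨i, j⟩) ≫ g i) ≫ f) := by
  refine Eval.comp (p := fun i => Pi.lift (fun i => Pi.lift (fun j : J i =>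
        Pi.π (fun y : Σ i, J i => col (b y.1 y.2)) ⟨i, j⟩) ≫ g i) ≫ Pi.π _ i)
    (q := fun i j => Pi.π (fun y : Σ i, J i => col (b y.1 y.2)) ⟨i, j⟩)
    (fun i j => hc.antichain) (fun i j => (hb i).above j) (fun i => ?_) (h.precomp _)
    fun i hi => hi.antisymm (hc.above i)
  have h'' := (h' i).precomp (Pi.lift (fun j : J i =>
        Pi.π (fun y : Σ i, J i => col (b y.1 y.2)) ⟨i, j⟩))
  simp only [Pi.lift_π] at h'' ⊢
  exact h''

variable (col τ)

theorem exists_eval {d : T.Edge} (h : T.Gen c d) : ∀ [Finite I],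
    ∃ f : (∏ᶜ fun i => col (c i)) ⟶ col d, Eval col τ c (Pi.π fun i => col (c i)) d f := by
  induction h with
  | unit a => exact fun {_} => ⟨_, .proj (c := fun _ : Unit => a) ()⟩
  | vertex v =>
    exact fun {_} => ⟨_, .vertex v (fun a => a.2.ne_out) _ fun a =>
      .proj (c := fun a : T.Input v => a.1) a⟩
  | reindex σ h ih =>
    intro _
    have := h.finite
    obtain ⟨f, hf⟩ := ih
    exact ⟨_, hf.reindex_π σ⟩
  | comp h h' ih ih' =>
    intro _
    have := h.finite
    have := fun i => (h' i).finite
    obtain ⟨f, hf⟩ := ih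
    choose g hg using fun i => ih' i
    exact ⟨_, Eval.comp_π h h' hf hg⟩

/-- The arrow which evaluates an operation of `Ω(T)`. -/
noncomputable def evalArrow [Finite I] {d : T.Edge} (h : T.Gen c d) :
    (∏ᶜ fun i => col (c i)) ⟶ col d :=
  (exists_eval col τ h).choose

theorem eval_evalArrow [Finite I] {d : T.Edge} (h : T.Gen c d) :
    Eval col τ c (Pi.π fun i => col (c i)) d (evalArrow col τ h) :=
  (exists_eval col τ h).choose_spec

variable {col τ} in
theorem Eval.evalArrow_eq [Finite I] {d : T.Edge} (h : T.Gen c d)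
    {f : (∏ᶜ fun i => col (c i)) ⟶ col d} (hf : Eval col τ c (Pi.π fun i => col (c i)) d f) :
    evalArrow col τ h = f :=
  eq_of_heq ((eval_evalArrow col τ h).heq
    (fun i j e => h.antichain (by rw [e]; exact .refl)) hf rfl)

/-- The dendrex of the nerve of `S` with given labels of the edges and given arrows for the
vertices. -/
noncomputable def homOfVertices : OperadHom T.operad (cartesianOperad S) where
  colour := col
  map p := evalArrow col τ p.down
  -- In each of the three laws the right-hand side is also an evaluation of the same operation, and
  -- evaluation is single-valued.
  map_unit a := Eval.evalArrow_eq _ (.proj (c := fun _ : Unit => a) ())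
  map_reindex σ _ _ p := Eval.evalArrow_eq _ ((eval_evalArrow col τ p.down).reindex_π σ)
  map_comp p q := Eval.evalArrow_eq _
    (Eval.comp_π p.down (fun i => (q i).down) (eval_evalArrow col τ p.down)
      fun i => eval_evalArrow col τ (q i).down)

theorem homOfVertices_map_vertex (v : T.Vertex) :
    (homOfVertices col τ).map (PLift.up (Gen.vertex v)) = τ v := by
  have h : Eval col τ (fun a : T.Input v => a.1) (Pi.π fun a : T.Input v => col a.1) (T.out v)
      (Pi.lift (Pi.π fun a : T.Input v => col a.1) ≫ τ v) :=
    .vertex v (fun a => a.2.ne_out) _ fun a => .proj (c := fun a : T.Input v => a.1) a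
  have e : Pi.lift (Pi.π fun a : T.Input v => col a.1) = 𝟙 _ :=
    Pi.hom_ext _ _ fun a => by simp
  rw [e, Category.id_comp] at h
  exact h.evalArrow_eq (Gen.vertex v)

end Eval

/-! ### The nerve of `S` is a strict inner Kan complex -/

theorem exists_heq_corolla {J : Type} [Finite J]
    (s : OperadHom (corolla J).operad (cartesianOperad S)) (col : Option J → S)
    (h : s.colour = col) : ∃ τ : (∏ᶜ fun j => col (some j)) ⟶ col none,
      HEq τ (s.map (PLift.up corolla_gen)) := by
  subst h
  exact ⟨_, HEq.rfl⟩

theorem nerve_horn_unique {T : OpTree} (e : T.InnerEdge)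
    {t t' : OperadHom T.operad (cartesianOperad S)}
    (h : ∀ {R : OpTree} (r : R ⟶ T), InHorn e r → pull r t = pull r t') : t = t' := by
  refine ext_of_pull_corolla (funext fun a => ?_) fun v => ?_
  · exact congrArg (fun s : OperadHom eta.operad (cartesianOperad S) => s.colour ())
      (h (edgeMap a) (inHorn_of_not_isFull e _ (not_isFull_edgeMap e a)))
  · exact h _ (inHorn_of_not_isFull e _ (not_isFull_corollaMap_vertex e v))

/-- The labels are read off from the edges and the arrows from the corollas of the vertices.
Agreement with the given family is checked on the vertices of each face. A vertex of an outer face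
is a vertex of `T`; the corolla of a vertex of `T/f`, for `f ≠ e`, factors through an outer face. -/
theorem nerve_horn_exists {T : OpTree} (e : T.InnerEdge)
    (s : ∀ {R : OpTree} (r : R ⟶ T), InHorn e r → OperadHom R.operad (cartesianOperad S))
    (hs : ∀ {R U : OpTree} (r : R ⟶ T) (hr : InHorn e r) (α : U ⟶ R),
      s (α ≫ r) (hr.precomp α) = pull α (s r hr)) :
    ∃ t : OperadHom T.operad (cartesianOperad S),
      ∀ {R : OpTree} (r : R ⟶ T) (hr : InHorn e r), pull r t = s r hr := by
  have hedge : ∀ a, InHorn e (edgeMap a) := fun a =>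
    inHorn_of_not_isFull e _ (not_isFull_edgeMap e a)
  have hvertex : ∀ v, InHorn e (corollaMap (Gen.vertex v)) := fun v =>
    inHorn_of_not_isFull e _ (not_isFull_corollaMap_vertex e v)
  let col : T.Edge → S := fun a => (s (edgeMap a) (hedge a)).colour ()
  have hcol : ∀ {R : OpTree} (r : R ⟶ T) (hr : InHorn e r),
      (s r hr).colour = fun a => col (r.1 a) := fun r hr => funext fun a =>
    (congrArg (fun s : OperadHom eta.operad (cartesianOperad S) => s.colour ())
      (hs r hr (edgeMap a))).symm
  -- The labels of a corolla in the family equal those given by `col` only propositionally, so its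
  -- arrow is retyped over `col`.
  choose τ hτ using fun v => exists_heq_corolla _ _ (hcol _ (hvertex v))
  let t : OperadHom T.operad (cartesianOperad S) := homOfVertices col τ
  have hv : ∀ v, pull (corollaMap (Gen.vertex v)) t = s _ (hvertex v) := fun v =>
    OperadHom.ext_corolla (hcol _ (hvertex v)).symm
      ((heq_of_eq (homOfVertices_map_vertex col τ v)).trans (hτ v))
  have hpull : ∀ {R : OpTree} (r : R ⟶ T) (hr : InHorn e r),
      (∀ u, pull (corollaMap (Gen.vertex u) ≫ r) t = s (corollaMap (Gen.vertex u) ≫ r)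
        (hr.precomp (corollaMap (Gen.vertex u)))) → pull r t = s r hr := fun r hr h =>
    ext_of_pull_corolla (hcol r hr).symm fun u =>
      (h u).trans (hs r hr (corollaMap (Gen.vertex u)))
  have hprecomp : ∀ {R U : OpTree} (r : R ⟶ T) (hr : InHorn e r) (α : U ⟶ R),
      pull r t = s r hr → pull (α ≫ r) t = s (α ≫ r) (hr.precomp α) := fun r hr α h =>
    (congrArg (pull α) h).trans (hs r hr α).symm
  have hfactor : ∀ {R U : OpTree} (r : R ⟶ T) (hr : InHorn e r) (α : U ⟶ R) (r' : U ⟶ T)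
      (hr' : InHorn e r'), r' = α ≫ r → pull r t = s r hr → pull r' t = s r' hr' := by
    rintro R U r hr α _ hr' rfl h
    exact hprecomp r hr α h
  have hprune : ∀ w, pull (pruneMap w) t = s _ (inHorn_pruneMap e w) := fun w =>
    hpull _ _ fun u => hfactor _ (hvertex u.1)
      (corollaMap (Gen.reindex (pruneInput w u) corolla_gen)) _ _
      (corolla_hom_ext rfl fun _ => rfl) (hv u.1)
  refine ⟨t, ?_⟩
  rintro R _ ⟨F, hF, g, rfl⟩
  refine hprecomp _ (inHorn_face hF) g ?_
  cases F with
  | outer w => exact hprune w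
  | inner f =>
    refine hpull _ _ fun u => ?_
    obtain ⟨w, k, hk⟩ := factors_of_not_isFull e _
      (not_isFull_corollaMap_contract (fun h => hF (by rw [h])) u)
    exact hfactor _ (inHorn_pruneMap e w) k _ _ ((corollaMap_comp _ _).trans hk) (hprune w)
  | edge h a => exact hpull _ _ fun u => u.elim

end Cartesian

end Dendroidal

namespace Dendroidal

open OpTree

/-! ### Inner horns in terms of elements -/

theorem mem_innerHorn_iff {T R : OpTree} (e : T.InnerEdge) (r : R ⟶ T) :
    (ULift.up r : ULift.{w} (R ⟶ T)) ∈ (innerHorn.{w} T e).obj (op R) ↔ InHorn e r := by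
  simp only [innerHorn, Subfunctor.iSup_obj, Set.mem_iUnion]
  constructor
  · rintro ⟨F, hF, ⟨g⟩, hg⟩
    exact ⟨F, hF, g, (congrArg ULift.down hg).symm⟩
  · rintro ⟨F, hF, g, rfl⟩
    exact ⟨F, hF, ⟨g⟩, rfl⟩

/-- A compatible family of dendrices of `K` indexed by the elements of the horn `Λ^e[T]`. -/
structure HornFamily (K : DSet.{w}) (T : OpTree) (e : T.InnerEdge) where
  /-- the dendrices -/
  val {R : OpTree} (r : R ⟶ T) : InHorn e r → K.obj (op R)
  map_val {R U : OpTree} (r : R ⟶ T) (hr : InHorn e r) (α : U ⟶ R) :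
    K.map α.op (val r hr) = val (α ≫ r) (hr.precomp α)

/-- A dendrex of shape `T` is a filler of a family indexed by a horn if it restricts to it. -/
def HornFamily.IsFiller {K : DSet.{w}} {T : OpTree} {e : T.InnerEdge} (y : HornFamily K T e)
    (z : K.obj (op T)) : Prop :=
  ∀ {R : OpTree} (r : R ⟶ T) (hr : InHorn e r), K.map r.op z = y.val r hr

/-- Maps out of the horn are compatible families, and maps out of `Ω[T]` are dendrices by the Yoneda
lemma. -/
theorem isInnerKan_iff (K : DSet.{w}) :
    IsInnerKan K ↔ ∀ (T : OpTree) (e : T.InnerEdge) (y : HornFamily K T e), ∃ z, y.IsFiller z := by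
  constructor
  · intro h T e y
    let φ : (innerHorn.{w} T e).toFunctor ⟶ K :=
      { app := fun U => ↾fun x => y.val x.1.down ((mem_innerHorn_iff e _).1 x.2)
        naturality := by
          intro U V α
          ext ⟨⟨r⟩, hr⟩
          exact (y.map_val r ((mem_innerHorn_iff e r).1 hr) α.unop).symm }
    obtain ⟨f, hf⟩ := h T e φ
    refine ⟨uliftYonedaEquiv.{w} f, fun {R} r hr => ?_⟩
    have h₁ : f.app (op R) ⟨r⟩ = y.val r hr :=
      ConcreteCategory.congr_hom (congr_app hf (op R)) ⟨⟨r⟩, (mem_innerHorn_iff e r).2 hr⟩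
    exact (NatTrans.naturality_apply f r.op ⟨𝟙 T⟩).symm.trans h₁
  · intro h T e φ
    let y : HornFamily K T e :=
      { val := fun {R} r hr => φ.app (op R) ⟨⟨r⟩, (mem_innerHorn_iff e r).2 hr⟩
        map_val := fun r hr α =>
          (NatTrans.naturality_apply φ α.op ⟨⟨r⟩, (mem_innerHorn_iff e r).2 hr⟩).symm }
    obtain ⟨z, hz⟩ := h T e y
    refine ⟨uliftYonedaEquiv.{w}.symm z, ?_⟩
    ext U ⟨⟨r⟩, hr⟩
    exact hz r ((mem_innerHorn_iff e r).1 hr)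

theorem restrictToHorn_injective_iff (K : DSet.{w}) (T : OpTree) (e : T.InnerEdge) :
    Function.Injective (restrictToHorn K T e) ↔
      ∀ z z' : K.obj (op T), (∀ {R : OpTree} (r : R ⟶ T), InHorn e r →
        K.map r.op z = K.map r.op z') → z = z' := by
  constructor
  · intro h z z' hz
    refine (uliftYonedaEquiv.{w} (F := K)).symm.injective (h ?_)
    ext U ⟨⟨r⟩, hr⟩
    exact hz r ((mem_innerHorn_iff e r).1 hr)
  · intro h f f' hf
    refine uliftYonedaEquiv.{w}.injective (h _ _ fun {R} r hr => ?_)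
    have h₁ : f.app (op R) ⟨r⟩ = f'.app (op R) ⟨r⟩ :=
      ConcreteCategory.congr_hom (congr_app hf (op R)) ⟨⟨r⟩, (mem_innerHorn_iff e r).2 hr⟩
    exact (NatTrans.naturality_apply f r.op ⟨𝟙 T⟩).symm.trans
      (h₁.trans (NatTrans.naturality_apply f' r.op ⟨𝟙 T⟩))

section Grothendieck

variable {S : Type u} [Category.{v} S] [HasFiniteProducts S]

/-! ### Functoriality of `in(α)` -/

/-- The projection from `in(t)` to the label of a leaf. -/
noncomputable def leafProj {T : OpTree} (t : OperadHom T.operad (cartesianOperad S))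
    (l : T.Leaf) : inObj t ⟶ label t l.1 :=
  Pi.π (fun l : T.Leaf => label t l.1) l

/-- The projection from `in(t)` to the leaves above an edge, followed by the arrow which `t`
associates to the subtree above this edge. -/
noncomputable def edgeArrow {T : OpTree} (t : OperadHom T.operad (cartesianOperad S))
    (a : T.Edge) : inObj t ⟶ label t a :=
  Pi.lift (fun m : T.LeafAbove a => leafProj t ⟨m.1, m.2.1⟩) ≫ arrow t (gen_leafAbove a)

/-- Each leaf above `d` is above exactly one input `c i`. Up to reindexing, the subtree above `d` is
thus the operation `h` with the subtrees above its inputs grafted on, and `t` preserves compositions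
and reindexings. -/
theorem edgeArrow_eq {T : OpTree} (t : OperadHom T.operad (cartesianOperad S)) {I : Type}
    [Finite I] {c : I → T.Edge} {d : T.Edge} (h : T.Gen c d) :
    edgeArrow t d = Pi.lift (fun i => edgeArrow t (c i)) ≫ arrow t h := by
  choose g hg using fun l : T.LeafAbove d => h.cover l.2.1 l.2.2
  let σ : T.LeafAbove d ≃ Σ i, T.LeafAbove (c i) :=
    { toFun := fun l => ⟨g l, ⟨l.1, l.2.1, hg l⟩⟩
      invFun := fun x => ⟨x.2.1, x.2.2.1, x.2.2.2.trans (h.above x.1)⟩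
      left_inv := fun _ => rfl
      right_inv := by
        rintro ⟨i, l, hl, hli⟩
        have key : ∀ j (hj : T.Above l (c j)), j = i →
            (⟨j, ⟨l, hl, hj⟩⟩ : Σ i, T.LeafAbove (c i)) = ⟨i, ⟨l, hl, hli⟩⟩ := by
          rintro _ _ rfl
          rfl
        have hgl := hg ⟨l, hl, hli.trans (h.above i)⟩
        refine key _ hgl ?_
        rcases Above.total hgl hli with h' | h'
        · exact h.antichain h'
        · exact (h.antichain h').symm }
  let q : ∀ i, T.Gen (fun l : T.LeafAbove (c i) => l.1) (c i) := fun i => gen_leafAbove (c i)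
  have h₁ : arrow t (gen_leafAbove d) = (Pi.reindex σ fun x => label t x.2.1).hom ≫
      Pi.lift (fun i => Pi.lift (fun j : T.LeafAbove (c i) =>
        Pi.π (fun x : Σ i, T.LeafAbove (c i) => label t x.2.1) ⟨i, j⟩) ≫ arrow t (q i)) ≫
        arrow t h :=
    (t.map_reindex σ (PLift.up (Gen.comp h q))).trans
      (congrArg ((Pi.reindex σ fun x : Σ i, T.LeafAbove (c i) => label t x.2.1).hom ≫ ·)
        (t.map_comp (PLift.up h) fun i => PLift.up (q i)))
  have h₂ : Pi.lift (fun m : T.LeafAbove d => leafProj t ⟨m.1, m.2.1⟩) ≫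
      (Pi.reindex σ fun x => label t x.2.1).hom =
      Pi.lift fun x : Σ i, T.LeafAbove (c i) => leafProj t ⟨x.2.1, x.2.2.1⟩ := by
    refine pi_hom_ext_equiv σ fun l => ?_
    refine (Category.assoc _ _ _).trans (Eq.trans ?_ (Pi.lift_π
      (fun x : Σ i, T.LeafAbove (c i) => leafProj t ⟨x.2.1, x.2.2.1⟩) (σ l)).symm)
    exact (congrArg (_ ≫ ·) (Pi.reindex_hom_π σ (fun x => label t x.2.1) l)).trans (Pi.lift_π _ _)
  rw [edgeArrow, h₁, ← Category.assoc, h₂, ← Category.assoc]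
  congr 1
  refine Pi.hom_ext _ _ fun i => ?_
  rw [Category.assoc, Pi.lift_π, Pi.lift_π, edgeArrow, ← Category.assoc]
  congr 1
  refine Pi.hom_ext _ _ fun l => ?_
  rw [Category.assoc, Pi.lift_π, Pi.lift_π, Pi.lift_π]

theorem edgeArrow_leaf {T : OpTree} (t : OperadHom T.operad (cartesianOperad S)) (l : T.Leaf) :
    edgeArrow t l.1 = leafProj t l := by
  let σ : Unit ≃ T.LeafAbove l.1 :=
    { toFun := fun _ => ⟨l.1, l.2, .refl⟩
      invFun := fun _ => ()
      left_inv := fun _ => rfl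
      right_inv := fun m => Subtype.ext (l.2.eq_of_above m.2.2).symm }
  have h₁ : (Pi.reindex σ fun m : T.LeafAbove l.1 => label t m.1).hom ≫
      arrow t (gen_leafAbove l.1) = Pi.π (fun _ : Unit => label t l.1) () :=
    (t.map_reindex σ (PLift.up (gen_leafAbove l.1))).symm.trans (t.map_unit l.1)
  have h₂ : Pi.lift (fun m : T.LeafAbove l.1 => leafProj t ⟨m.1, m.2.1⟩) =
      Pi.lift (fun _ : Unit => leafProj t l) ≫
        (Pi.reindex σ fun m : T.LeafAbove l.1 => label t m.1).hom := by
    refine pi_hom_ext_equiv σ fun i => ?_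
    refine (Pi.lift_π (fun m : T.LeafAbove l.1 => leafProj t ⟨m.1, m.2.1⟩) (σ i)).trans
      (Eq.trans ?_ (Category.assoc _ _ _).symm)
    refine Eq.trans ?_ (congrArg (_ ≫ ·)
      (Pi.reindex_hom_π σ (fun m : T.LeafAbove l.1 => label t m.1) i)).symm
    exact (Pi.lift_π (fun _ : Unit => leafProj t l) i).symm
  rw [edgeArrow, h₂]
  refine (Category.assoc _ _ _).trans ((congrArg (_ ≫ ·) h₁).trans ?_)
  exact Pi.lift_π (fun _ : Unit => leafProj t l) ()

theorem inMap_π {R T : OpTree} (α : R ⟶ T) (t : OperadHom T.operad (cartesianOperad S))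
    (l : R.Leaf) : inMap α t ≫ leafProj (pull α t) l = edgeArrow t (α.1 l.1) :=
  Pi.lift_π _ _

/-- This is `edgeArrow_eq` for the image under `α` of the subtree of `R` above `a`. At the leaves of
`R` it yields the functoriality of `in`. -/
theorem inMap_edgeArrow {R T : OpTree} (α : R ⟶ T) (t : OperadHom T.operad (cartesianOperad S))
    (a : R.Edge) : inMap α t ≫ edgeArrow (pull α t) a = edgeArrow t (α.1 a) := by
  rw [edgeArrow_eq t (α.2 (R.gen_leafAbove a)), edgeArrow, ← Category.assoc]
  refine congrArg (· ≫ arrow t (α.2 (R.gen_leafAbove a))) ?_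
  refine Pi.hom_ext _ _ fun l => ?_
  exact (Category.assoc _ _ _).trans ((congrArg (_ ≫ ·) (Pi.lift_π _ _)).trans
    ((inMap_π α t ⟨l.1, l.2.1⟩).trans
      (Pi.lift_π (fun i : R.LeafAbove a => edgeArrow t (α.1 i.1)) l).symm))

theorem inMap_comp {R T U : OpTree} (α : U ⟶ R) (r : R ⟶ T)
    (t : OperadHom T.operad (cartesianOperad S)) :
    inMap (α ≫ r) t = inMap r t ≫ inMap α (pull r t) := by
  refine Pi.hom_ext _ _ fun l => ?_
  refine (inMap_π (α ≫ r) t l).trans (Eq.trans ?_ (Category.assoc _ _ _).symm)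
  exact (inMap_edgeArrow r t (α.1 l.1)).symm.trans
    (congrArg (_ ≫ ·) (inMap_π α (pull r t) l).symm)

/-- At edges sent to leaves the components of `in(r)` are plain projections, so `in(r)` only
permutes the factors along the bijection of leaves. -/
theorem isIso_inMap {R T : OpTree} (r : R ⟶ T) (hr : IsFull r)
    (t : OperadHom T.operad (cartesianOperad S)) : IsIso (inMap r t) := by
  let φ : R.Leaf ≃ T.Leaf := Equiv.ofBijective hr.leafMap hr.leafMap_bijective
  have h : (Pi.reindex φ fun l : T.Leaf => label t l.1).hom ≫ inMap r t = 𝟙 _ := by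
    refine Pi.hom_ext _ _ fun l => ?_
    refine (Category.assoc _ _ _).trans (Eq.trans ?_ (Category.id_comp _).symm)
    refine (congrArg (_ ≫ ·) ((inMap_π r t l).trans (edgeArrow_leaf t (φ l)))).trans ?_
    exact Pi.reindex_hom_π φ (fun l : T.Leaf => label t l.1) l
  exact @isIso_of_hom_comp_eq_id _ _ _ _ _
    (Iso.isIso_hom (Pi.reindex φ fun l : T.Leaf => label t l.1)) _ h

omit [HasFiniteProducts S] in
theorem map_comp_app_apply (X : Sᵒᵖ ⥤ DSet.{w}) {A B C : S} (f : A ⟶ B) (g : B ⟶ C)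
    {R : OpTree} (x : (X.obj (op C)).obj (op R)) :
    (X.map (f ≫ g).op).app (op R) x = (X.map f.op).app (op R) ((X.map g.op).app (op R) x) := by
  simp

/-! ### Dendrices of the Grothendieck construction -/

namespace GrothendieckDendrex

variable {X : Sᵒᵖ ⥤ DSet.{w}}

/-- Restriction of a dendrex along a morphism of trees. -/
noncomputable def restrict {R T : OpTree} (y : GrothendieckDendrex X T) (r : R ⟶ T) :
    GrothendieckDendrex X R :=
  (grothendieck X).map r.op y

/-- The value of a dendrex at the identity, as a dendrex of `X(in(t))`. -/
noncomputable def value {T : OpTree} (y : GrothendieckDendrex X T)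
    (t : OperadHom T.operad (cartesianOperad S)) (h : y.t = t) :
    (X.obj (op (inObj t))).obj (op T) :=
  h ▸ (y.x (𝟙 T) : (X.obj (op (inObj y.t))).obj (op T))

/-- This is the compatibility condition at the identity. The label `t` is a parameter, so that
dendrices whose labels are only propositionally equal can be compared over the same object of `S`.
-/
theorem map_value {R T : OpTree} (y : GrothendieckDendrex X T)
    (t : OperadHom T.operad (cartesianOperad S)) (h : y.t = t) (r : R ⟶ T) :
    (X.obj (op (inObj t))).map r.op (y.value t h) =
      (X.map (inMap r t).op).app (op R)
        ((y.restrict r).value (pull r t) (congrArg (pull r) h)) := by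
  subst h
  exact y.compat (𝟙 T) r

theorem ext_value {T : OpTree} {y y' : GrothendieckDendrex X T}
    {t : OperadHom T.operad (cartesianOperad S)} (ht : y.t = t) (ht' : y'.t = t)
    (h : ∀ {R : OpTree} (r : R ⟶ T), (y.restrict r).value (pull r t) (congrArg (pull r) ht) =
      (y'.restrict r).value (pull r t) (congrArg (pull r) ht')) : y = y' := by
  obtain ⟨s, x, hx⟩ := y
  obtain ⟨s', x', hx'⟩ := y'
  obtain rfl : s = t := ht
  obtain rfl : s' = s := ht'
  obtain rfl : @x = @x' := by
    funext R r
    exact h r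
  rfl

end GrothendieckDendrex

/-! ### Filling horns in the Grothendieck construction -/

open GrothendieckDendrex

variable {X : Sᵒᵖ ⥤ DSet.{w}} {T : OpTree} {e : T.InnerEdge}

/-- The family of dendrices of `X(in(t))` given by the values, transported along the arrows
`in(r)`, of a family of dendrices of the Grothendieck construction. -/
noncomputable def HornFamily.values (y : HornFamily (grothendieck X) T e)
    (t : OperadHom T.operad (cartesianOperad S))
    (ht : ∀ {R : OpTree} (r : R ⟶ T) (hr : InHorn e r), (y.val r hr).t = pull r t) :
    HornFamily (X.obj (op (inObj t))) T e where
  val {R} r hr := (X.map (inMap r t).op).app (op R)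
    (value (y.val r hr : GrothendieckDendrex X R) (pull r t) (ht r hr))
  map_val {R U} r hr α := by
    have h₁ : restrict (y.val r hr : GrothendieckDendrex X R) α = y.val (α ≫ r) (hr.precomp α) :=
      y.map_val r hr α
    have h₂ := map_value (y.val r hr : GrothendieckDendrex X R) (pull r t) (ht r hr) α
    simp only [h₁] at h₂
    refine (NatTrans.naturality_apply (X.map (inMap r t).op) α.op _).symm.trans ?_
    refine (congrArg ((X.map (inMap r t).op).app (op U)) h₂).trans ?_
    refine (map_comp_app_apply X _ _ _).symm.trans ?_
    -- The transports along `in(α)` and `in(r)` combine into one along `in(α ≫ r)`.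
    exact congrArg (fun f : inObj t ⟶ inObj (pull (α ≫ r) t) => (X.map f.op).app (op U) _)
      (inMap_comp α r t).symm

omit [HasFiniteProducts S] in
theorem map_app_injective (X : Sᵒᵖ ⥤ DSet.{w}) {A B : S} (f : A ⟶ B) [IsIso f] {R : OpTree}
    {x x' : (X.obj (op B)).obj (op R)}
    (h : (X.map f.op).app (op R) x = (X.map f.op).app (op R) x') : x = x' := by
  have h' := congrArg ((X.map (inv f).op).app (op R)) h
  rw [← map_comp_app_apply, ← map_comp_app_apply] at h'
  simpa using h'

theorem isIso_inMap_of_not_inHorn {R : OpTree} (r : R ⟶ T) (hr : ¬ InHorn e r)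
    (t : OperadHom T.operad (cartesianOperad S)) : IsIso (inMap r t) :=
  isIso_inMap r (not_not.1 fun h => hr (inHorn_of_not_isFull e r h)) t

section Filler

variable (y : HornFamily (grothendieck X) T e) (t : OperadHom T.operad (cartesianOperad S))
  (ht : ∀ {R : OpTree} (r : R ⟶ T) (hr : InHorn e r), (y.val r hr).t = pull r t)
  (z : (X.obj (op (inObj t))).obj (op T))

open Classical in
/-- The values of the filler of a horn in the Grothendieck construction obtained from a filler in
`X(in(t))`.  If `r` is not in the horn, then `in(r)` is invertible. -/
noncomputable def HornFamily.fillerValue {R : OpTree} (r : R ⟶ T) :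
    (X.obj (op (inObj (pull r t)))).obj (op R) :=
  if hr : InHorn e r then value (y.val r hr : GrothendieckDendrex X R) (pull r t) (ht r hr)
  else
    have : IsIso (inMap r t) := isIso_inMap_of_not_inHorn r hr t
    (X.map (inv (inMap r t)).op).app (op R) ((X.obj (op (inObj t))).map r.op z)

theorem HornFamily.fillerValue_of_inHorn {R : OpTree} (r : R ⟶ T) (hr : InHorn e r) :
    y.fillerValue t ht z r = value (y.val r hr : GrothendieckDendrex X R) (pull r t) (ht r hr) :=
  dif_pos hr

/-- In the horn this is the filling property of `z`, outside it the definition by the inverse of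
`in(r)`. One equation for all `r` makes it unnecessary to ask whether `α ≫ r` is in the horn when
`r` is not. -/
theorem HornFamily.map_inMap_fillerValue (hz : (y.values t ht).IsFiller z) {R : OpTree}
    (r : R ⟶ T) : (X.map (inMap r t).op).app (op R) (y.fillerValue t ht z r) =
      (X.obj (op (inObj t))).map r.op z := by
  by_cases hr : InHorn e r
  · rw [y.fillerValue_of_inHorn t ht z r hr]
    exact (hz r hr).symm
  · have : IsIso (inMap r t) := isIso_inMap_of_not_inHorn r hr t
    rw [HornFamily.fillerValue, dif_neg hr, ← map_comp_app_apply, IsIso.hom_inv_id]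
    simp

/-- The filler of a horn in the Grothendieck construction obtained from a filler in
`X(in(t))`. -/
noncomputable def HornFamily.filler (hz : (y.values t ht).IsFiller z) :
    GrothendieckDendrex X T where
  t := t
  x r := y.fillerValue t ht z r
  compat {R U} r α := by
    by_cases hr : InHorn e r
    · have h₁ : restrict (y.val r hr : GrothendieckDendrex X R) α =
        y.val (α ≫ r) (hr.precomp α) := y.map_val r hr α
      have h₂ := map_value (y.val r hr : GrothendieckDendrex X R) (pull r t) (ht r hr) α
      simp only [h₁] at h₂
      rw [y.fillerValue_of_inHorn t ht z r hr,
        y.fillerValue_of_inHorn t ht z (α ≫ r) (hr.precomp α)]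
      exact h₂
    · have : IsIso (inMap r t) := isIso_inMap_of_not_inHorn r hr t
      -- As `in(r)` is invertible, both sides may be compared in `X(in(t))`, where each becomes the
      -- restriction of `z` along `α ≫ r`.
      refine map_app_injective X (inMap r t) ?_
      refine (NatTrans.naturality_apply (X.map (inMap r t).op) α.op _).trans ?_
      refine (congrArg _ (y.map_inMap_fillerValue t ht z hz r)).trans ?_
      refine Eq.trans ?_ (map_comp_app_apply X _ _ _)
      refine Eq.trans ?_ (congrArg (fun f : inObj t ⟶ inObj (pull (α ≫ r) t) =>
        (X.map f.op).app (op U) (y.fillerValue t ht z (α ≫ r))) (inMap_comp α r t))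
      refine Eq.trans ?_ (y.map_inMap_fillerValue t ht z hz (α ≫ r)).symm
      simp

theorem HornFamily.isFiller_filler (hz : (y.values t ht).IsFiller z) :
    y.IsFiller (y.filler t ht z hz : (grothendieck X).obj (op T)) := by
  intro R r hr
  refine ext_value (t := pull r t) rfl (ht r hr) fun {U} α => ?_
  refine (y.fillerValue_of_inHorn t ht z (α ≫ r) (hr.precomp α)).trans ?_
  have h₁ : restrict (y.val r hr : GrothendieckDendrex X R) α =
      y.val (α ≫ r) (hr.precomp α) := y.map_val r hr α
  simp only [h₁]
  rfl

end Filler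

/-! ### Existence and uniqueness of fillers -/

theorem HornFamily.exists_label (y : HornFamily (grothendieck X) T e) :
    ∃ t : OperadHom T.operad (cartesianOperad S),
      ∀ {R : OpTree} (r : R ⟶ T) (hr : InHorn e r), (y.val r hr).t = pull r t := by
  obtain ⟨t, ht⟩ := nerve_horn_exists e
    (fun {R} r hr => GrothendieckDendrex.t (y.val r hr : GrothendieckDendrex X R))
    fun r hr α => (congrArg GrothendieckDendrex.t (y.map_val r hr α)).symm
  exact ⟨t, fun r hr => (ht r hr).symm⟩

theorem isInnerKan_grothendieck (h : ∀ A : S, IsInnerKan (X.obj (op A))) :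
    IsInnerKan (grothendieck X) := by
  refine (isInnerKan_iff _).2 fun T e y => ?_
  obtain ⟨t, ht⟩ := y.exists_label
  obtain ⟨z, hz⟩ := (isInnerKan_iff _).1 (h (inObj t)) T e (y.values t ht)
  exact ⟨_, y.isFiller_filler t ht z hz⟩

/-- In the strict case, a dendrex of the Grothendieck construction is determined by its
restriction to an inner horn. -/
theorem grothendieck_horn_unique (h : ∀ A : S, IsStrictInnerKan (X.obj (op A)))
    {y y' : GrothendieckDendrex X T}
    (hy : ∀ {R : OpTree} (r : R ⟶ T), InHorn e r → y.restrict r = y'.restrict r) : y = y' := by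
  have ht : y'.t = y.t := nerve_horn_unique e fun r hr =>
    (congrArg GrothendieckDendrex.t (hy r hr)).symm
  -- Both values at the identity restrict to the same horn in `X(in(t))`, where fillers are unique.
  have hid : y.value y.t rfl = y'.value y.t ht := by
    refine (restrictToHorn_injective_iff _ T e).1 (h (inObj y.t) T e).1 _ _ fun r hr => ?_
    refine (map_value y y.t rfl r).trans (Eq.trans ?_ (map_value y' y.t ht r).symm)
    simp only [hy r hr]
  refine ext_value (t := y.t) rfl ht fun r => ?_
  by_cases hr : InHorn e r
  · simp only [hy r hr]
  -- Outside the horn the value at `r` is recovered from the value at the identity by inverting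
  -- `in(r)`.
  · have : IsIso (inMap r y.t) := isIso_inMap_of_not_inHorn r hr y.t
    refine map_app_injective X (inMap r y.t) ?_
    refine (map_value y y.t rfl r).symm.trans (Eq.trans ?_ (map_value y' y.t ht r))
    rw [hid]

theorem isStrictInnerKan_grothendieck (h : ∀ A : S, IsStrictInnerKan (X.obj (op A))) :
    IsStrictInnerKan (grothendieck X) := fun T e =>
  ⟨(restrictToHorn_injective_iff _ T e).2 fun _ _ hy => grothendieck_horn_unique h hy,
    isInnerKan_grothendieck (fun A T e => (h A T e).2) T e⟩

end Grothendieck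

end Dendroidal

theorem theorem8p2 {S : Type u} [Category.{v} S] [HasFiniteProducts S]
    (X : Sᵒᵖ ⥤ Dendroidal.DSet.{w}) :
    ((∀ A : S, Dendroidal.IsInnerKan (X.obj (op A))) →
      Dendroidal.IsInnerKan (Dendroidal.grothendieck X)) ∧
    ((∀ A : S, Dendroidal.IsStrictInnerKan (X.obj (op A))) →
      Dendroidal.IsStrictInnerKan (Dendroidal.grothendieck X)) :=
  ⟨Dendroidal.isInnerKan_grothendieck, Dendroidal.isStrictInnerKan_grothendieck⟩
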